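/- Let $k$ be a commutative ring, $R$ a (possibly non-commutative) $k$-algebra, $R^e = R\otimes_k R^{\mathrm{op}}$, and let ${}_R\mathcal M_R$ be the monoidal category of $R$-$R$-bimodules over $k$, identified with the category of left $R^e$-modules via $(r\otimes r')\cdot x = r\cdot x\cdot r'$, with monoidal product $\otimes_R$ and unit $R$. A bimonad on a monoidal category $\mathcal M$ with unit object $i$ is a monad $(T,\mu,\eta)$ on $\mathcal M$ together with a lax comonoidal (oplax monoidal) structure $\gamma_{x,y}\colon T(x\otimes y)\to Tx\otimes Ty$, $\pi\colon Ti\to i$ on the functor $T$ such that $\mu$ and $\eta$ are comonoidal natural transformations. An isomorphism of bimonads on $\mathcal M$ is an isomorphism of the underlying monads that is comonoidal. A left bialgebroid (Takeuchi $\times_R$-bialgebra) over $R$ consists of a $k$-algebra $A$, a $k$-algebra map $s\otimes t\colon R\otimes_k R^{\mathrm{op}}\to A$, which makes $A$ an $R$-$R$-bimodule by $r\cdot a\cdot r' = s(r)t(r')a$, and a comonoid structure $(A,\Delta,\varepsilon)$ on $A$ in ${}_R\mathcal M_R$ such that - $\Delta(A)\subseteq A\times_R A := \{X\in A\otimes_R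 A \mid X(1\otimes s(r)) = X(t(r)\otimes 1)\ \text{for all } r\in R\}$, and $\Delta\colon A\to A\times_R A$ is a $k$-algebra map for the multiplication $(\sum_i x_i\otimes x_i')(\sum_j y_j\otimes y_j') = \sum_{i,j} x_iy_j\otimes x_i'y_j'$ and unit $1\otimes 1$ of $A\times_R A$; - $\varepsilon(1_A)=1_R$ and $\varepsilon(a\,t(\varepsilon(b))) = \varepsilon(ab) = \varepsilon(a\,s(\varepsilon(b)))$ for all $a,b\in A$. The bimonad of a left bialgebroid $A$ is the functor $A\otimes_{R^e}-$ on ${}_R\mathcal M_R$ (where $A$ is a right $R^e$-module by right multiplication along $s\otimes t$), with structure maps, writing $\Delta(a)=a_{(1)}\otimes a_{(2)}$, $$\mu_X(a\otimes(b\otimes x)) = ab\otimes x,\qquad \eta_X(x) = 1_A\otimes x,$$ $$\gamma_{X,Y}(a\otimes(x\otimes y)) = (a_{(1)}\otimes x)\otimes(a_{(2)}\otimes y),\qquad \pi(a\otimes r) = \varepsilon(a\,s(r)).$$ Theorem. Let $(T,\gamma,\pi,\mu,\eta)$ be a bimonad on ${}_R\mathcal M_R$ whose underlying functor $T$ is $k$-linear.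 Then $T$ is isomorphic, as a bimonad, to the bimonad $A\otimes_{R^e}-$ of a left bialgebroid $A$ over $R$ if and only if the functor $T$ has a right adjoint. -/

import Mathlib

open CategoryTheory MonoidalCategory

universe w u

noncomputable section

namespace Bimonads

/-! ### Balanced tensor products over non-commutative rings -/

section Balanced

open scoped TensorProduct

variable {S M N P : Type*} [AddCommGroup M] [AddCommGroup N] [AddCommGroup P]

/-- The subgroup of `M ⊗ N` generated by the elements `m·s ⊗ n - m ⊗ s·n`, where
`m·s = ρ s m` and `s·n = l s n`. -/
def balancedRel (ρ : S → M → M) (l : S → N → N) : AddSubgroup (M ⊗[ℤ] N) :=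
  AddSubgroup.closure {z | ∃ (s : S) (m : M) (n : N), z = ρ s m ⊗ₜ[ℤ] n - m ⊗ₜ[ℤ] l s n}

/-- The tensor product `M ⊗_S N` of a right `S`-module `M` and a left `S`-module `N` over a
(possibly non-commutative) ring `S`; the actions are given by `m·s = ρ s m` and `s·n = l s n`. -/
def Balanced (ρ : S → M → M) (l : S → N → N) : Type _ :=
  (M ⊗[ℤ] N) ⧸ balancedRel ρ l

namespace Balanced

variable {ρ : S → M → M} {l : S → N → N}

instance : AddCommGroup (Balanced ρ l) :=
  inferInstanceAs (AddCommGroup ((M ⊗[ℤ] N) ⧸ balancedRel ρ l))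

variable (ρ l) in
/-- The class of `m ⊗ n` in `M ⊗_S N`, as a biadditive map. -/
def mk : M →+ N →+ Balanced ρ l :=
  AddMonoidHom.mk' (fun m => (QuotientAddGroup.mk' (balancedRel ρ l)).comp
      (TensorProduct.mk ℤ M N m).toAddMonoidHom) (by
    intro a b
    ext n
    change QuotientAddGroup.mk' (balancedRel ρ l) ((a + b) ⊗ₜ[ℤ] n) =
      QuotientAddGroup.mk' (balancedRel ρ l) (a ⊗ₜ[ℤ] n) +
        QuotientAddGroup.mk' (balancedRel ρ l) (b ⊗ₜ[ℤ] n)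
    rw [TensorProduct.add_tmul, map_add])

theorem mk_balanced (s : S) (m : M) (n : N) : mk ρ l (ρ s m) n = mk ρ l m (l s n) := by
  change QuotientAddGroup.mk' (balancedRel ρ l) (ρ s m ⊗ₜ[ℤ] n) =
    QuotientAddGroup.mk' (balancedRel ρ l) (m ⊗ₜ[ℤ] l s n)
  rw [← sub_eq_zero, ← map_sub]
  exact (QuotientAddGroup.eq_zero_iff _).2 (AddSubgroup.subset_closure ⟨s, m, n, rfl⟩)

/-- The additive map out of `M ⊗_S N` induced by a balanced biadditive map. -/
def lift (f : M →+ N →+ P) (hf : ∀ s m n, f (ρ s m) n = f m (l s n)) : Balanced ρ l →+ P :=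
  QuotientAddGroup.lift (balancedRel ρ l)
    (TensorProduct.liftAddHom f (fun r m n => by simp))
    (by
      rw [balancedRel, AddSubgroup.closure_le]
      rintro _ ⟨s, m, n, rfl⟩
      change TensorProduct.liftAddHom f _ (ρ s m ⊗ₜ[ℤ] n - m ⊗ₜ[ℤ] l s n) = 0
      rw [map_sub, TensorProduct.liftAddHom_tmul, TensorProduct.liftAddHom_tmul, hf, sub_self])

@[simp]
theorem lift_mk (f : M →+ N →+ P) (hf : ∀ s m n, f (ρ s m) n = f m (l s n)) (m : M) (n : N) :
    lift f hf (mk ρ l m n) = f m n := rfl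

theorem induction {p : Balanced ρ l → Prop} (z : Balanced ρ l)
    (hm : ∀ m n, p (mk ρ l m n)) (ha : ∀ x y, p x → p y → p (x + y)) : p z := by
  obtain ⟨z, rfl⟩ := QuotientAddGroup.mk'_surjective (balancedRel ρ l) z
  induction z using TensorProduct.induction_on with
  | zero =>
    have h := hm 0 0
    rw [map_zero] at h
    rw [map_zero]
    exact h
  | tmul m n => exact hm m n
  | add x y hx hy => rw [map_add]; exact ha _ _ hx hy

theorem addHom_ext {f g : Balanced ρ l →+ P} (h : ∀ m n, f (mk ρ l m n) = g (mk ρ l m n)) :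
    f = g := by
  ext z
  induction z using induction with
  | hm m n => exact h m n
  | ha x y hx hy => rw [map_add, map_add, hx, hy]

end Balanced

end Balanced

/-! ### The monoidal category of bimodules -/

section Env

open scoped TensorProduct

/-- The enveloping algebra `R ⊗_k Rᵒᵖ`. -/
abbrev Env (k : Type w) (R : Type u) [CommRing k] [Ring R] [Algebra k R] : Type u :=
  R ⊗[k] Rᵐᵒᵖ

variable (k : Type w) {R : Type u} [CommRing k] [Ring R] [Algebra k R]

/-- The element `r ⊗ 1` of the enveloping algebra. -/
def sE (r : R) : Env k R := r ⊗ₜ[k] (1 : Rᵐᵒᵖ)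

/-- The element `1 ⊗ r` of the enveloping algebra. -/
def tE (r : R) : Env k R := (1 : R) ⊗ₜ[k] MulOpposite.op r

variable {k}

theorem sE_mul_tE (r r' : R) : sE k r * tE k r' = r ⊗ₜ[k] MulOpposite.op r' := by
  simp [sE, tE]

theorem tE_mul_sE (r r' : R) : tE k r' * sE k r = r ⊗ₜ[k] MulOpposite.op r' := by
  simp [sE, tE]

theorem sE_tE_comm (r r' : R) : sE k r * tE k r' = tE k r' * sE k r := by
  rw [sE_mul_tE, tE_mul_sE]

theorem sE_mul (r r' : R) : sE k (r * r') = sE k r * sE k r' := by simp [sE]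

theorem tE_mul (r r' : R) : tE k (r * r') = tE k r' * tE k r := by simp [tE]

theorem sE_add (r r' : R) : sE k (r + r') = sE k r + sE k r' := by
  simp [sE, TensorProduct.add_tmul]

theorem tE_add (r r' : R) : tE k (r + r') = tE k r + tE k r' := by
  simp [tE, TensorProduct.tmul_add]

@[simp] theorem sE_one : sE k (1 : R) = 1 := rfl

@[simp] theorem tE_one : tE k (1 : R) = 1 := rfl

theorem sE_algebraMap (c : k) : sE k (algebraMap k R c) = tE k (algebraMap k R c) := by
  simp [sE, tE, Algebra.algebraMap_eq_smul_one, TensorProduct.smul_tmul]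

theorem sE_smul (c : k) (r : R) : sE k (c • r) = tE k (algebraMap k R c) * sE k r := by
  rw [Algebra.smul_def, sE_mul, sE_algebraMap]

theorem tE_smul (c : k) (r : R) : tE k (c • r) = sE k (algebraMap k R c) * tE k r := by
  rw [Algebra.smul_def, Algebra.commutes, tE_mul, sE_algebraMap]

theorem env_induction {p : Env k R → Prop} (e : Env k R)
    (hm : ∀ r r', p (sE k r * tE k r')) (ha : ∀ x y, p x → p y → p (x + y)) : p e := by
  induction e using TensorProduct.induction_on with
  | zero => simpa [sE] using hm 0 0
  | tmul m n => simpa [sE_mul_tE] using hm m n.unop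
  | add x y hx hy => exact ha _ _ hx hy

/-- A biadditive, `k`-balanced map out of `R × R` induces an additive map out of the
enveloping algebra. -/
def envLift {P : Type*} [AddCommGroup P] (f : R →+ R →+ P)
    (hf : ∀ (c : k) r r', f (c • r) r' = f r (c • r')) : Env k R →+ P :=
  TensorProduct.liftAddHom
    ((AddMonoidHom.compHom' (MulOpposite.opAddEquiv (α := R)).symm.toAddMonoidHom).comp f)
    (fun c r r' => hf c r r'.unop)

@[simp]
theorem envLift_apply {P : Type*} [AddCommGroup P] (f : R →+ R →+ P)
    (hf : ∀ (c : k) r r', f (c • r) r' = f r (c • r')) (r r' : R) :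
    envLift f hf (sE k r * tE k r') = f r r' := by
  rw [sE_mul_tE]; rfl

end Env

/-- The category `_R M_R` of `R`-`R`-bimodules over the commutative ring `k`, realised as the
category of left modules over the enveloping algebra `R ⊗_k Rᵒᵖ`:
`r·x = (r ⊗ 1)·x` and `x·r = (1 ⊗ r)·x`. -/
abbrev BimodCat (k : Type w) (R : Type u) [CommRing k] [Ring R] [Algebra k R] : Type (u + 1) :=
  ModuleCat.{u} (Env k R)

namespace BimodCat

variable {k : Type w} {R : Type u} [CommRing k] [Ring R] [Algebra k R]

/-- An additive map that commutes with the left and right `R`-actions is a bimodule morphism. -/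
def homMk {X Y : BimodCat k R} (f : X →+ Y) (hs : ∀ (r : R) x, f (sE k r • x) = sE k r • f x)
    (ht : ∀ (r : R) x, f (tE k r • x) = tE k r • f x) : X ⟶ Y :=
  ModuleCat.ofHom
    { toFun := f
      map_add' := map_add f
      map_smul' := fun e x => by
        induction e using env_induction with
        | hm r r' => simp only [mul_smul, hs, ht, RingHom.id_apply]
        | ha a b ha hb => simp only [add_smul, map_add, RingHom.id_apply] at *; rw [ha, hb] }

@[simp]
theorem homMk_apply {X Y : BimodCat k R} (f : X →+ Y) (hs) (ht) (x : X) :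
    (homMk f hs ht : X ⟶ Y).hom x = f x := rfl

/-- The additive group `X ⊗_R Y`: here `x·r ⊗ y = x ⊗ r·y`. -/
abbrev Tens (X Y : BimodCat k R) : Type u :=
  Balanced (S := R) (fun r (x : X) => tE k r • x) (fun r (y : Y) => sE k r • y)

/-- The pure tensor `x ⊗ y` in `X ⊗_R Y`, as a biadditive map. -/
abbrev tmk (X Y : BimodCat k R) : X →+ Y →+ Tens X Y :=
  Balanced.mk (S := R) (fun r (x : X) => tE k r • x) (fun r (y : Y) => sE k r • y)

theorem tmk_bal {X Y : BimodCat k R} (r : R) (x : X) (y : Y) :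
    tmk X Y (tE k r • x) y = tmk X Y x (sE k r • y) :=
  Balanced.mk_balanced (ρ := fun r (x : X) => tE k r • x) (l := fun r (y : Y) => sE k r • y) r x y

/-- The additive endomorphism `x ⊗ y ↦ r·x ⊗ y·r'` of `X ⊗_R Y`. -/
def biact (X Y : BimodCat k R) : R →+ R →+ (Tens X Y →+ Tens X Y) :=
  AddMonoidHom.mk' (fun r => AddMonoidHom.mk' (fun r' =>
    Balanced.lift
      (AddMonoidHom.mk' (fun x => AddMonoidHom.mk' (fun y =>
        tmk X Y (sE k r • x) (tE k r' • y)) (by intro a b; simp)) (by intro a b; ext y; simp))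
      (by
        intro q x y
        change tmk X Y (sE k r • tE k q • x) (tE k r' • y) =
          tmk X Y (sE k r • x) (tE k r' • sE k q • y)
        rw [← mul_smul, sE_tE_comm, mul_smul, tmk_bal, ← mul_smul, ← mul_smul, sE_tE_comm]))
      (by
        intro a b
        apply Balanced.addHom_ext
        intro x y
        change tmk X Y _ _ = tmk X Y _ _ + tmk X Y _ _
        rw [tE_add, add_smul, map_add]))
    (by
      intro a b
      ext r' : 1
      apply Balanced.addHom_ext
      intro x y
      change tmk X Y _ _ = tmk X Y _ _ + tmk X Y _ _
      rw [sE_add, add_smul, map_add, AddMonoidHom.add_apply])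

theorem biact_mk (X Y : BimodCat k R) (r r' : R) (x : X) (y : Y) :
    biact X Y r r' (tmk X Y x y) = tmk X Y (sE k r • x) (tE k r' • y) := rfl

/-- The action of the enveloping algebra on `X ⊗_R Y`. -/
def act (X Y : BimodCat k R) : Env k R →+ (Tens X Y →+ Tens X Y) :=
  envLift (biact X Y) (by
    intro c r r'
    apply Balanced.addHom_ext
    intro x y
    change tmk X Y _ _ = tmk X Y _ _
    rw [sE_smul, tE_smul, mul_smul, mul_smul, tmk_bal])

@[simp]
theorem act_mk (X Y : BimodCat k R) (r r' : R) (x : X) (y : Y) :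
    act X Y (sE k r * tE k r') (tmk X Y x y) = tmk X Y (sE k r • x) (tE k r' • y) := by
  rw [act, envLift_apply, biact_mk]

instance (X Y : BimodCat k R) : Module (Env k R) (Tens X Y) where
  smul e z := act X Y e z
  one_smul z := by
    change act X Y 1 z = z
    induction z using Balanced.induction with
    | hm x y => simpa using act_mk X Y 1 1 x y
    | ha a b ha hb => rw [map_add, ha, hb]
  mul_smul e f z := by
    change act X Y (e * f) z = act X Y e (act X Y f z)
    induction z using Balanced.induction with
    | ha a b ha hb => simp only [map_add, ha, hb]
    | hm x y =>
      induction e using env_induction with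
      | ha a b ha hb => simp only [add_mul, map_add, AddMonoidHom.add_apply, ha, hb]
      | hm r r' =>
        induction f using env_induction with
        | ha a b ha hb => simp only [mul_add, map_add, AddMonoidHom.add_apply, ha, hb]
        | hm q q' =>
          have : sE k r * tE k r' * (sE k q * tE k q') = sE k (r * q) * tE k (q' * r') := by
            rw [sE_mul, tE_mul, mul_assoc, ← mul_assoc (tE k r'), ← sE_tE_comm]
            simp only [mul_assoc]
          rw [this]
          erw [act_mk, act_mk, act_mk]
          rw [sE_mul, tE_mul, mul_smul, mul_smul]
  smul_zero e := map_zero _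
  smul_add e := map_add _
  add_smul e f z := by
    change act X Y (e + f) z = act X Y e z + act X Y f z
    rw [map_add, AddMonoidHom.add_apply]
  zero_smul z := by
    change act X Y 0 z = 0
    rw [map_zero, AddMonoidHom.zero_apply]

theorem sE_smul_mk {X Y : BimodCat k R} (r : R) (x : X) (y : Y) :
    sE k r • tmk X Y x y = tmk X Y (sE k r • x) y := by
  change act X Y (sE k r) (tmk X Y x y) = _
  simpa using act_mk X Y r 1 x y

theorem tE_smul_mk {X Y : BimodCat k R} (r : R) (x : X) (y : Y) :
    tE k r • tmk X Y x y = tmk X Y x (tE k r • y) := by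
  change act X Y (tE k r) (tmk X Y x y) = _
  simpa using act_mk X Y 1 r x y

/-- A biadditive function as a homomorphism. -/
def biadd {M N P : Type*} [AddCommGroup M] [AddCommGroup N] [AddCommGroup P] (f : M → N → P)
    (h₁ : ∀ m m' n, f (m + m') n = f m n + f m' n)
    (h₂ : ∀ m n n', f m (n + n') = f m n + f m n') : M →+ N →+ P :=
  AddMonoidHom.mk' (fun m => AddMonoidHom.mk' (f m) (h₂ m)) (fun m m' => by ext n; exact h₁ m m' n)

/-- The tensor product `X ⊗_R Y` with the bimodule structure `r·(x ⊗ y)·r' = r·x ⊗ y·r'`. -/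
def tens (X Y : BimodCat k R) : BimodCat k R := ModuleCat.of (Env k R) (Tens X Y)

/-- The pure tensor `x ⊗ y` in the bimodule `X ⊗_R Y`. -/
def tm {X Y : BimodCat k R} (x : X) (y : Y) : tens X Y := tmk X Y x y

section tm

variable {X Y Z W V : BimodCat k R}

theorem tm_add_left (x x' : X) (y : Y) : tm (x + x') y = tm x y + tm x' y := by
  change tmk X Y _ _ = tmk X Y _ _ + tmk X Y _ _
  rw [map_add, AddMonoidHom.add_apply]

theorem tm_add_right (x : X) (y y' : Y) : tm x (y + y') = tm x y + tm x y' :=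
  map_add (tmk X Y x) y y'

theorem tm_bal (r : R) (x : X) (y : Y) : tm (tE k r • x) y = tm x (sE k r • y) := tmk_bal r x y

theorem sE_tm (r : R) (x : X) (y : Y) : sE k r • tm x y = tm (sE k r • x) y := sE_smul_mk r x y

theorem tE_tm (r : R) (x : X) (y : Y) : tE k r • tm x y = tm x (tE k r • y) := tE_smul_mk r x y

theorem tens_induction {p : tens X Y → Prop} (z : tens X Y) (hm : ∀ x y, p (tm x y))
    (ha : ∀ a b, p a → p b → p (a + b)) : p z :=
  Balanced.induction (p := p) z hm ha

/-- The additive map out of `X ⊗_R Y` induced by a balanced biadditive map. -/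
def tlift {P : Type*} [AddCommGroup P] (f : X →+ Y →+ P)
    (hb : ∀ (r : R) x y, f (tE k r • x) y = f x (sE k r • y)) : tens X Y →+ P :=
  Balanced.lift f hb

theorem tlift_tm {P : Type*} [AddCommGroup P] (f : X →+ Y →+ P) (hb) (x : X) (y : Y) :
    tlift f hb (tm x y) = f x y := rfl

theorem taddHom_ext {P : Type*} [AddCommGroup P] {f g : tens X Y →+ P}
    (h : ∀ x y, f (tm x y) = g (tm x y)) : f = g := by
  ext z
  induction z using tens_induction with
  | hm x y => exact h x y
  | ha a b ha hb => rw [map_add, map_add, ha, hb]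

/-- The bimodule morphism out of `X ⊗_R Y` induced by a balanced map. -/
def liftHom (f : X →+ Y →+ Z) (hb : ∀ (r : R) x y, f (tE k r • x) y = f x (sE k r • y))
    (hs : ∀ (r : R) x y, f (sE k r • x) y = sE k r • f x y)
    (ht : ∀ (r : R) x y, f x (tE k r • y) = tE k r • f x y) : tens X Y ⟶ Z :=
  homMk (X := tens X Y) (tlift f hb)
    (fun r z => by
      induction z using tens_induction with
      | hm x y => rw [sE_tm]; exact hs r x y
      | ha a b ha hb => rw [smul_add, map_add, map_add, smul_add, ha, hb])
    (fun r z => by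
      induction z using tens_induction with
      | hm x y => rw [tE_tm]; exact ht r x y
      | ha a b ha hb => rw [smul_add, map_add, map_add, smul_add, ha, hb])

theorem liftHom_tm (f : X →+ Y →+ Z) (hb) (hs) (ht) (x : X) (y : Y) :
    (liftHom f hb hs ht : tens X Y ⟶ Z).hom (tm x y) = f x y := rfl

theorem hom_ext₂ {f g : tens X Y ⟶ Z} (h : ∀ x y, f.hom (tm x y) = g.hom (tm x y)) : f = g := by
  ext z
  induction z using tens_induction with
  | hm x y => exact h x y
  | ha a b ha hb => rw [map_add, map_add, ha, hb]

theorem hom_ext₃ {f g : tens (tens X Y) Z ⟶ W}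
    (h : ∀ x y z, f.hom (tm (tm x y) z) = g.hom (tm (tm x y) z)) : f = g := by
  apply hom_ext₂
  intro t z
  induction t using tens_induction with
  | hm x y => exact h x y z
  | ha a b ha hb => rw [tm_add_left, map_add, map_add, ha, hb]

theorem hom_ext₃' {f g : tens X (tens Y Z) ⟶ W}
    (h : ∀ x y z, f.hom (tm x (tm y z)) = g.hom (tm x (tm y z))) : f = g := by
  apply hom_ext₂
  intro x t
  induction t using tens_induction with
  | hm y z => exact h x y z
  | ha a b ha hb => rw [tm_add_right, map_add, map_add, ha, hb]

theorem hom_ext₄ {f g : tens (tens (tens X Y) Z) W ⟶ V}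
    (h : ∀ x y z w, f.hom (tm (tm (tm x y) z) w) = g.hom (tm (tm (tm x y) z) w)) : f = g := by
  apply hom_ext₃
  intro t z w
  induction t using tens_induction with
  | hm x y => exact h x y z w
  | ha a b ha hb => rw [tm_add_left, tm_add_left, map_add, map_add, ha, hb]

end tm

section structureMaps

variable {X X' Y Y' : BimodCat k R}

/-- The tensor product `x ⊗ y ↦ f x ⊗ g y` of two bimodule morphisms. -/
def tensMap (f : X ⟶ X') (g : Y ⟶ Y') : tens X Y ⟶ tens X' Y' :=
  liftHom (biadd (fun x y => tm (f.hom x) (g.hom y))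
      (fun x x' y => by rw [map_add, tm_add_left])
      (fun x y y' => by rw [map_add, tm_add_right]))
    (fun r x y => by
      change tm (f.hom (tE k r • x)) _ = tm _ (g.hom (sE k r • y))
      rw [map_smul, map_smul, tm_bal])
    (fun r x y => by
      change tm (f.hom (sE k r • x)) _ = sE k r • tm _ _
      rw [map_smul, sE_tm])
    (fun r x y => by
      change tm _ (g.hom (tE k r • y)) = tE k r • tm _ _
      rw [map_smul, tE_tm])

theorem tensMap_tm (f : X ⟶ X') (g : Y ⟶ Y') (x : X) (y : Y) :
    (tensMap f g).hom (tm x y) = tm (f.hom x) (g.hom y) := rfl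

variable (k R) in
/-- The regular action `(r ⊗ r')·x = r x r'` of the enveloping algebra on `R`. -/
def regAct : Env k R →+ (R →+ R) :=
  envLift (biadd (fun r r' => (AddMonoidHom.mulLeft r).comp (AddMonoidHom.mulRight r'))
      (fun a b c => by ext x; simp [add_mul])
      (fun a b c => by ext x; simp [mul_add]))
    (fun c r r' => by
      ext x
      change (c • r) * (x * r') = r * (x * (c • r'))
      simp)

theorem regAct_apply (r r' x : R) : regAct k R (sE k r * tE k r') x = r * (x * r') := by
  rw [regAct, envLift_apply]; rfl

variable (k R) in
/-- The regular bimodule structure `r·x·r' = r x r'` on `R`. -/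
@[reducible]
def regModule : Module (Env k R) R where
  smul e x := regAct k R e x
  one_smul x := by
    change regAct k R 1 x = x
    simpa using regAct_apply (k := k) 1 1 x
  mul_smul e f x := by
    change regAct k R (e * f) x = regAct k R e (regAct k R f x)
    induction e using env_induction with
    | ha a b ha hb => simp only [add_mul, map_add, AddMonoidHom.add_apply, ha, hb]
    | hm r r' =>
      induction f using env_induction with
      | ha a b ha hb => simp only [mul_add, map_add, AddMonoidHom.add_apply, ha, hb]
      | hm q q' =>
        have : sE k r * tE k r' * (sE k q * tE k q') = sE k (r * q) * tE k (q' * r') := by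
          rw [sE_mul, tE_mul, mul_assoc, ← mul_assoc (tE k r'), ← sE_tE_comm]
          simp only [mul_assoc]
        rw [this, regAct_apply, regAct_apply, regAct_apply]
        simp only [mul_assoc]
  smul_zero e := map_zero _
  smul_add e := map_add _
  add_smul e f z := by
    change regAct k R (e + f) z = regAct k R e z + regAct k R f z
    rw [map_add, AddMonoidHom.add_apply]
  zero_smul z := by
    change regAct k R 0 z = 0
    rw [map_zero, AddMonoidHom.zero_apply]

variable (k R) in
/-- The regular bimodule `R`. -/
def unit : BimodCat k R := @ModuleCat.of (Env k R) _ R _ (regModule k R)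

/-- An element of `R`, regarded as an element of the regular bimodule. -/
def toUnit (r : R) : unit k R := r

/-- An element of the regular bimodule, regarded as an element of `R`. -/
def ofUnit (x : unit k R) : R := x

theorem sE_unit (r : R) (x : unit k R) : sE k r • x = toUnit (r * ofUnit x) := by
  change regAct k R (sE k r) (ofUnit x) = r * ofUnit x
  simpa using regAct_apply (k := k) r 1 (ofUnit x)

theorem tE_unit (r : R) (x : unit k R) : tE k r • x = toUnit (ofUnit x * r) := by
  change regAct k R (tE k r) (ofUnit x) = ofUnit x * r
  simpa using regAct_apply (k := k) 1 r (ofUnit x)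

/-- The additive map `x ⊗ y ↦ (z ↦ x ⊗ (y ⊗ z))`. -/
def assocAdd (X Y Z : BimodCat k R) : tens X Y →+ Z →+ tens X (tens Y Z) :=
  tlift
    (AddMonoidHom.mk' (fun x => biadd (fun (y : Y) (z : Z) => tm x (tm y z))
        (fun a b c => by rw [tm_add_left, tm_add_right])
        (fun a b c => by rw [tm_add_right, tm_add_right]))
      (fun a b => by
        apply AddMonoidHom.ext
        intro y
        apply AddMonoidHom.ext
        intro z
        exact tm_add_left a b (tm y z)))
    (fun r x y => by
      apply AddMonoidHom.ext
      intro z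
      change tm (tE k r • x) (tm y z) = tm x (tm (sE k r • y) z)
      rw [tm_bal, sE_tm])

theorem assocAdd_tm {X Y Z : BimodCat k R} (x : X) (y : Y) (z : Z) :
    assocAdd X Y Z (tm x y) z = tm x (tm y z) := rfl

/-- The associativity isomorphism `(x ⊗ y) ⊗ z ↦ x ⊗ (y ⊗ z)`. -/
def assocHom (X Y Z : BimodCat k R) : tens (tens X Y) Z ⟶ tens X (tens Y Z) :=
  liftHom (assocAdd X Y Z)
    (fun r t z => by
      induction t using tens_induction with
      | hm x y => rw [tE_tm, assocAdd_tm, assocAdd_tm, tm_bal]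
      | ha a b ha hb =>
        rw [smul_add, map_add, map_add, AddMonoidHom.add_apply, AddMonoidHom.add_apply, ha, hb])
    (fun r t z => by
      induction t using tens_induction with
      | hm x y => rw [sE_tm, assocAdd_tm, assocAdd_tm, sE_tm]
      | ha a b ha hb =>
        rw [smul_add, map_add, map_add, AddMonoidHom.add_apply, AddMonoidHom.add_apply, ha, hb,
          smul_add])
    (fun r t z => by
      induction t using tens_induction with
      | hm x y => rw [assocAdd_tm, assocAdd_tm, tE_tm, tE_tm]
      | ha a b ha hb =>
        rw [map_add, AddMonoidHom.add_apply, AddMonoidHom.add_apply, ha, hb, smul_add])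

theorem assocHom_tm {X Y Z : BimodCat k R} (x : X) (y : Y) (z : Z) :
    (assocHom X Y Z).hom (tm (tm x y) z) = tm x (tm y z) := rfl

/-- The additive map `x ↦ (y ⊗ z ↦ (x ⊗ y) ⊗ z)`. -/
def assocInvAdd (X Y Z : BimodCat k R) : X →+ tens Y Z →+ tens (tens X Y) Z :=
  AddMonoidHom.mk' (fun x => tlift
      (biadd (fun (y : Y) (z : Z) => tm (tm x y) z)
          (fun a b c => by rw [tm_add_right, tm_add_left])
          (fun a b c => by rw [tm_add_right]))
        (fun r y z => by
          change tm (tm x (tE k r • y)) z = tm (tm x y) (sE k r • z)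
          rw [← tE_tm, tm_bal]))
      (fun a b => by
        apply taddHom_ext
        intro y z
        change tm (tm (a + b) y) z = tm (tm a y) z + tm (tm b y) z
        rw [tm_add_left, tm_add_left])

theorem assocInvAdd_tm {X Y Z : BimodCat k R} (x : X) (y : Y) (z : Z) :
    assocInvAdd X Y Z x (tm y z) = tm (tm x y) z := rfl

/-- The inverse associativity isomorphism `x ⊗ (y ⊗ z) ↦ (x ⊗ y) ⊗ z`. -/
def assocInv (X Y Z : BimodCat k R) : tens X (tens Y Z) ⟶ tens (tens X Y) Z :=
  liftHom (assocInvAdd X Y Z)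
    (fun r x t => by
      induction t using tens_induction with
      | hm y z => rw [sE_tm, assocInvAdd_tm, assocInvAdd_tm, tm_bal]
      | ha a b ha hb => rw [smul_add, map_add, map_add, ha, hb])
    (fun r x t => by
      induction t using tens_induction with
      | hm y z => rw [assocInvAdd_tm, assocInvAdd_tm, sE_tm, sE_tm]
      | ha a b ha hb => rw [map_add, map_add, ha, hb, smul_add])
    (fun r x t => by
      induction t using tens_induction with
      | hm y z => rw [tE_tm, assocInvAdd_tm, assocInvAdd_tm, tE_tm]
      | ha a b ha hb => rw [smul_add, map_add, map_add, ha, hb, smul_add])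

theorem assocInv_tm {X Y Z : BimodCat k R} (x : X) (y : Y) (z : Z) :
    (assocInv X Y Z).hom (tm x (tm y z)) = tm (tm x y) z := rfl

/-- The left unit isomorphism `r ⊗ x ↦ r·x`. -/
def lunitHom (X : BimodCat k R) : tens (unit k R) X ⟶ X :=
  liftHom
    (biadd (fun (r : unit k R) (x : X) => sE k (ofUnit r) • x)
      (fun a b c => by
        rw [← add_smul, ← sE_add]; rfl)
      (fun a b c => by rw [smul_add]))
    (fun r q x => by
      rw [tE_unit]
      change sE k (ofUnit q * r) • x = sE k (ofUnit q) • sE k r • x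
      rw [sE_mul, mul_smul])
    (fun r q x => by
      rw [sE_unit]
      change sE k (r * ofUnit q) • x = sE k r • sE k (ofUnit q) • x
      rw [sE_mul, mul_smul])
    (fun r q x => by
      change sE k (ofUnit q) • tE k r • x = tE k r • sE k (ofUnit q) • x
      rw [← mul_smul, sE_tE_comm, mul_smul])

theorem lunitHom_tm {X : BimodCat k R} (r : unit k R) (x : X) :
    (lunitHom X).hom (tm r x) = sE k (ofUnit r) • x := rfl

/-- The inverse left unit isomorphism `x ↦ 1 ⊗ x`. -/
def lunitInv (X : BimodCat k R) : X ⟶ tens (unit k R) X :=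
  homMk (X := X) (Y := tens (unit k R) X)
    (AddMonoidHom.mk' (fun x => tm (toUnit 1) x) (fun a b => tm_add_right _ a b))
    (fun r x => by
      change tm (toUnit 1) (sE k r • x) = sE k r • tm (toUnit 1) x
      rw [← tm_bal, sE_tm, tE_unit, sE_unit]
      simp [ofUnit, toUnit])
    (fun r x => by
      change tm (toUnit 1) (tE k r • x) = tE k r • tm (toUnit 1) x
      rw [tE_tm])

theorem lunitInv_apply {X : BimodCat k R} (x : X) : (lunitInv X).hom x = tm (toUnit 1) x := rfl

/-- The right unit isomorphism `x ⊗ r ↦ x·r`. -/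
def runitHom (X : BimodCat k R) : tens X (unit k R) ⟶ X :=
  liftHom
    (biadd (fun (x : X) (r : unit k R) => tE k (ofUnit r) • x)
      (fun a b c => by rw [smul_add])
      (fun a b c => by
        rw [← add_smul, ← tE_add]; rfl))
    (fun r x q => by
      rw [sE_unit]
      change tE k (ofUnit q) • tE k r • x = tE k (r * ofUnit q) • x
      rw [tE_mul, mul_smul])
    (fun r x q => by
      change tE k (ofUnit q) • sE k r • x = sE k r • tE k (ofUnit q) • x
      rw [← mul_smul, ← sE_tE_comm, mul_smul])
    (fun r x q => by
      rw [tE_unit]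
      change tE k (ofUnit q * r) • x = tE k r • tE k (ofUnit q) • x
      rw [tE_mul, mul_smul])

theorem runitHom_tm {X : BimodCat k R} (x : X) (r : unit k R) :
    (runitHom X).hom (tm x r) = tE k (ofUnit r) • x := rfl

/-- The inverse right unit isomorphism `x ↦ x ⊗ 1`. -/
def runitInv (X : BimodCat k R) : X ⟶ tens X (unit k R) :=
  homMk (X := X) (Y := tens X (unit k R))
    (AddMonoidHom.mk' (fun x => tm x (toUnit 1)) (fun a b => tm_add_left a b _))
    (fun r x => by
      change tm (sE k r • x) (toUnit 1) = sE k r • tm x (toUnit 1)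
      rw [sE_tm])
    (fun r x => by
      change tm (tE k r • x) (toUnit 1) = tE k r • tm x (toUnit 1)
      rw [tm_bal, tE_tm, tE_unit, sE_unit]
      simp [ofUnit, toUnit])

theorem runitInv_apply {X : BimodCat k R} (x : X) : (runitInv X).hom x = tm x (toUnit 1) := rfl

end structureMaps

instance : MonoidalCategoryStruct (BimodCat k R) where
  tensorObj X Y := tens X Y
  tensorHom f g := tensMap f g
  whiskerLeft X _ _ g := tensMap (𝟙 X) g
  whiskerRight f Y := tensMap f (𝟙 Y)
  tensorUnit := unit k R
  associator X Y Z :=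
    { hom := assocHom X Y Z
      inv := assocInv X Y Z
      hom_inv_id := hom_ext₃ fun _ _ _ => rfl
      inv_hom_id := hom_ext₃' fun _ _ _ => rfl }
  leftUnitor X :=
    { hom := lunitHom X
      inv := lunitInv X
      hom_inv_id := hom_ext₂ fun r x => by
        change tm (toUnit 1) (sE k (ofUnit r) • x) = tm r x
        rw [← tm_bal, tE_unit]
        exact congrArg (fun q : unit k R => tm q x) (one_mul (ofUnit r))
      inv_hom_id := by
        ext x
        change sE k (1 : R) • x = x
        rw [sE_one, one_smul] }
  rightUnitor X :=
    { hom := runitHom X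
      inv := runitInv X
      hom_inv_id := hom_ext₂ fun x r => by
        change tm (tE k (ofUnit r) • x) (toUnit 1) = tm x r
        rw [tm_bal, sE_unit]
        exact congrArg (fun q : unit k R => tm x q) (mul_one (ofUnit r))
      inv_hom_id := by
        ext x
        change tE k (1 : R) • x = x
        rw [tE_one, one_smul] }

/-- The monoidal category `(_R M_R, ⊗_R, R)`. -/
instance : MonoidalCategory (BimodCat k R) :=
  MonoidalCategory.ofTensorHom
    (id_tensorHom_id := fun X Y => hom_ext₂ fun _ _ => rfl)
    (id_tensorHom := fun X _ _ f => rfl)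
    (tensorHom_id := fun f Y => rfl)
    (tensorHom_comp_tensorHom := fun _ _ _ _ => hom_ext₂ fun _ _ => rfl)
    (associator_naturality := fun _ _ _ => hom_ext₃ fun _ _ _ => rfl)
    (leftUnitor_naturality := fun {X Y} f => by
      refine hom_ext₂ (X := unit k R) (Y := X) (Z := Y) fun r x => ?_
      change sE k (ofUnit r) • f.hom x = f.hom (sE k (ofUnit r) • x)
      rw [map_smul])
    (rightUnitor_naturality := fun {X Y} f => by
      refine hom_ext₂ (X := X) (Y := unit k R) (Z := Y) fun x r => ?_
      change tE k (ofUnit r) • f.hom x = f.hom (tE k (ofUnit r) • x)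
      rw [map_smul])
    (pentagon := fun _ _ _ _ => hom_ext₄ fun _ _ _ _ => rfl)
    (triangle := fun X Y => by
      refine hom_ext₃ (X := X) (Y := unit k R) (Z := Y) (W := tens X Y) fun x r y => ?_
      change tm x (sE k (ofUnit r) • y) = tm (tE k (ofUnit r) • x) y
      rw [tm_bal])

/-- A linear map over the enveloping algebra as a bimodule morphism. -/
def linHom {X Y : BimodCat k R} (f : X →ₗ[Env k R] Y) : X ⟶ Y := ModuleCat.ofHom f

section tmul

variable {X X' Y Y' Z : BimodCat k R}

/-- The pure tensor `x ⊗ y` as an element of the monoidal product `X ⊗ Y = X ⊗_R Y`. -/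
def tmul (x : X) (y : Y) : (X ⊗ Y : BimodCat k R) := tm x y

theorem tmul_add_left (x x' : X) (y : Y) : tmul (x + x') y = tmul x y + tmul x' y :=
  tm_add_left x x' y

theorem tmul_add_right (x : X) (y y' : Y) : tmul x (y + y') = tmul x y + tmul x y' :=
  tm_add_right x y y'

theorem tmul_bal (r : R) (x : X) (y : Y) : tmul (tE k r • x) y = tmul x (sE k r • y) :=
  tm_bal r x y

theorem sE_tmul (r : R) (x : X) (y : Y) : sE k r • tmul x y = tmul (sE k r • x) y := sE_tm r x y

theorem tE_tmul (r : R) (x : X) (y : Y) : tE k r • tmul x y = tmul x (tE k r • y) := tE_tm r x y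

theorem tmul_induction {p : (X ⊗ Y : BimodCat k R) → Prop} (z : (X ⊗ Y : BimodCat k R))
    (hm : ∀ x y, p (tmul x y)) (ha : ∀ a b, p a → p b → p (a + b)) : p z :=
  tens_induction (p := p) z hm ha

theorem tensor_hom_ext {f g : X ⊗ Y ⟶ Z} (h : ∀ x y, f.hom (tmul x y) = g.hom (tmul x y)) :
    f = g := hom_ext₂ h

/-- The additive map out of `X ⊗_R Y` induced by a balanced biadditive map. -/
def tensorLift {P : Type*} [AddCommGroup P] (f : X →+ Y →+ P)
    (hb : ∀ (r : R) x y, f (tE k r • x) y = f x (sE k r • y)) : (X ⊗ Y : BimodCat k R) →+ P :=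
  tlift f hb

theorem tensorLift_tmul {P : Type*} [AddCommGroup P] (f : X →+ Y →+ P) (hb) (x : X) (y : Y) :
    tensorLift f hb (tmul x y) = f x y := rfl

theorem tensorHom_tmul (f : X ⟶ X') (g : Y ⟶ Y') (x : X) (y : Y) :
    (f ⊗ₘ g).hom (tmul x y) = tmul (f.hom x) (g.hom y) := rfl

theorem whiskerLeft_tmul (X : BimodCat k R) (g : Y ⟶ Y') (x : X) (y : Y) :
    (X ◁ g).hom (tmul x y) = tmul x (g.hom y) := rfl

theorem whiskerRight_tmul (f : X ⟶ X') (Y : BimodCat k R) (x : X) (y : Y) :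
    (f ▷ Y).hom (tmul x y) = tmul (f.hom x) y := rfl

theorem associator_tmul (x : X) (y : Y) (z : Z) :
    (α_ X Y Z).hom.hom (tmul (tmul x y) z) = tmul x (tmul y z) := rfl

theorem tensorHom_add_left (f f' : X ⟶ X') (g : Y ⟶ Y') :
    ((f + f') ⊗ₘ g) = (f ⊗ₘ g) + (f' ⊗ₘ g) :=
  tensor_hom_ext fun x y => tmul_add_left (f.hom x) (f'.hom x) (g.hom y)

theorem tensorHom_add_right (f : X ⟶ X') (g g' : Y ⟶ Y') :
    (f ⊗ₘ (g + g')) = (f ⊗ₘ g) + (f ⊗ₘ g') :=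
  tensor_hom_ext fun x y => tmul_add_right (f.hom x) (g.hom y) (g'.hom y)

end tmul

end BimodCat

/-! ### Bimonads -/

/-- A bimonad on a monoidal category `C`: a monad `(T, μ, η)` on `C` together with a lax
comonoidal (that is, oplax monoidal) structure
`γ_{x,y} = δ T x y : T (x ⊗ y) ⟶ T x ⊗ T y`, `π = OplaxMonoidal.η T : T 𝟙 ⟶ 𝟙` on `T`
for which the natural transformations `μ` and `η` are comonoidal. -/
structure Bimonad (C : Type*) [Category* C] [MonoidalCategory C] where
  /-- the underlying monad -/
  monad : Monad C
  /-- the lax comonoidal structure of the underlying functor -/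
  comonoidal : monad.toFunctor.OplaxMonoidal
  mu_comul (x y : C) : monad.μ.app (x ⊗ y) ≫ comonoidal.δ x y =
    monad.map (comonoidal.δ x y) ≫ comonoidal.δ (monad.obj x) (monad.obj y) ≫
      (monad.μ.app x ⊗ₘ monad.μ.app y)
  mu_counit : monad.μ.app (𝟙_ C) ≫ comonoidal.η = monad.map comonoidal.η ≫ comonoidal.η
  eta_comul (x y : C) :
    monad.η.app (x ⊗ y) ≫ comonoidal.δ x y = (monad.η.app x ⊗ₘ monad.η.app y)
  eta_counit : monad.η.app (𝟙_ C) ≫ comonoidal.η = 𝟙 (𝟙_ C)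

/-- An isomorphism of bimonads on `C`: an isomorphism of the underlying monads which is
comonoidal. -/
structure BimonadIso {C : Type*} [Category* C] [MonoidalCategory C] (S T : Bimonad C) where
  /-- the isomorphism of the underlying monads -/
  iso : S.monad ≅ T.monad
  comul (x y : C) : S.comonoidal.δ x y ≫ (iso.hom.app x ⊗ₘ iso.hom.app y) =
    iso.hom.app (x ⊗ y) ≫ T.comonoidal.δ x y
  counit : S.comonoidal.η = iso.hom.app (𝟙_ C) ≫ T.comonoidal.η

/-! ### Left bialgebroids -/

open BimodCat

section Takeuchi

variable {k : Type w} {R : Type u} [CommRing k] [Ring R] [Algebra k R]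
variable {A : Type u} [Ring A] [Algebra k A] (ι : Env k R →ₐ[k] A)

/-- The algebra `A` as an `R`-`R`-bimodule via `r·a·r' = s(r) t(r') a`, where `s(r) = ι (r ⊗ 1)`
and `t(r) = ι (1 ⊗ r)`. -/
def bimodOf : BimodCat k R :=
  @ModuleCat.of (Env k R) _ A _ (Module.compHom A (ι : Env k R →+* A))

/-- An element of `A`, regarded as an element of the bimodule `A`. -/
def toBimod (a : A) : bimodOf ι := a

/-- An element of the bimodule `A`, regarded as an element of `A`. -/
def ofBimod (a : bimodOf ι) : A := a

theorem smul_bimodOf (e : Env k R) (a : bimodOf ι) : e • a = toBimod ι (ι e * ofBimod ι a) := rfl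

/-- Right multiplication by `b`, as an endomorphism of the bimodule `A`. -/
def rmul (b : A) : bimodOf ι ⟶ bimodOf ι :=
  linHom
    { toFun := fun a => toBimod ι (ofBimod ι a * b)
      map_add' := fun a a' => add_mul (ofBimod ι a) (ofBimod ι a') b
      map_smul' := fun e a => mul_assoc (ι e) (ofBimod ι a) b }

theorem rmul_apply (b : A) (a : bimodOf ι) :
    (rmul ι b).hom a = toBimod ι (ofBimod ι a * b) := rfl

theorem rmul_add (b b' : A) : rmul ι (b + b') = rmul ι b + rmul ι b' := by
  ext a
  exact mul_add (ofBimod ι a) b b'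

theorem rmul_comp (b b' : A) : rmul ι b ≫ rmul ι b' = rmul ι (b * b') := by
  ext a
  exact mul_assoc (ofBimod ι a) b b'

theorem rmul_one : rmul ι 1 = 𝟙 _ := by
  ext a
  exact mul_one (ofBimod ι a)

/-- The Takeuchi product
`A ×_R A = {X ∈ A ⊗_R A | X (1 ⊗ s(r)) = X (t(r) ⊗ 1) for all r ∈ R}`. -/
def takeuchi : AddSubgroup (bimodOf ι ⊗ bimodOf ι : BimodCat k R) where
  carrier := {X | ∀ r : R, (bimodOf ι ◁ rmul ι (ι (sE k r))).hom X =
    (rmul ι (ι (tE k r)) ▷ bimodOf ι).hom X}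
  add_mem' := fun {X Y} hX hY r => by rw [map_add, map_add, hX r, hY r]
  zero_mem' := fun r => by rw [map_zero, map_zero]
  neg_mem' := fun {X} hX r => by rw [map_neg, map_neg, hX r]

/-- The map `Y ↦ X Y` with `X (y ⊗ y') = ∑ x_i y ⊗ x'_i y'` for `X = ∑ x_i ⊗ x'_i`; it is well
defined for `X ∈ A ×_R A`. -/
def takeuchiMul (X : takeuchi ι) :
    (bimodOf ι ⊗ bimodOf ι : BimodCat k R) →+ (bimodOf ι ⊗ bimodOf ι : BimodCat k R) :=
  tensorLift
    (biadd (fun y y' => (rmul ι (ofBimod ι y) ⊗ₘ rmul ι (ofBimod ι y')).hom X.1)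
      (fun y y' z => by
        change (rmul ι (ofBimod ι y + ofBimod ι y') ⊗ₘ _).hom X.1 = _
        rw [rmul_add, tensorHom_add_left]; rfl)
      (fun y z z' => by
        change (_ ⊗ₘ rmul ι (ofBimod ι z + ofBimod ι z')).hom X.1 = _
        rw [rmul_add, tensorHom_add_right]; rfl))
    (fun r y y' => by
      change (rmul ι (ι (tE k r) * ofBimod ι y) ⊗ₘ rmul ι (ofBimod ι y')).hom X.1 =
        (rmul ι (ofBimod ι y) ⊗ₘ rmul ι (ι (sE k r) * ofBimod ι y')).hom X.1
      have h1 : (rmul ι (ι (tE k r) * ofBimod ι y) ⊗ₘ rmul ι (ofBimod ι y')) =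
          rmul ι (ι (tE k r)) ▷ bimodOf ι ≫ (rmul ι (ofBimod ι y) ⊗ₘ rmul ι (ofBimod ι y')) := by
        rw [whiskerRight_comp_tensorHom, rmul_comp]
      have h2 : (rmul ι (ofBimod ι y) ⊗ₘ rmul ι (ι (sE k r) * ofBimod ι y')) =
          bimodOf ι ◁ rmul ι (ι (sE k r)) ≫ (rmul ι (ofBimod ι y) ⊗ₘ rmul ι (ofBimod ι y')) := by
        rw [whiskerLeft_comp_tensorHom, rmul_comp]
      rw [h1, h2, ModuleCat.comp_apply, ModuleCat.comp_apply, X.2 r])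

theorem takeuchiMul_tmul (X : takeuchi ι) (y y' : bimodOf ι) :
    takeuchiMul ι X (tmul y y') =
      (rmul ι (ofBimod ι y) ⊗ₘ rmul ι (ofBimod ι y')).hom X.1 := rfl

theorem tensorHom_takeuchiMul (X : takeuchi ι) (z z' : A)
    (Y : (bimodOf ι ⊗ bimodOf ι : BimodCat k R)) :
    (rmul ι z ⊗ₘ rmul ι z').hom (takeuchiMul ι X Y) =
      takeuchiMul ι X ((rmul ι z ⊗ₘ rmul ι z').hom Y) := by
  induction Y using tmul_induction with
  | hm y y' =>
    rw [tensorHom_tmul, takeuchiMul_tmul, takeuchiMul_tmul, ← ModuleCat.comp_apply,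
      tensorHom_comp_tensorHom, rmul_comp, rmul_comp]
    rfl
  | ha a b ha hb => simp only [map_add, ha, hb]

/-- The multiplication of `A ×_R A`. -/
instance : Mul (takeuchi ι) where
  mul X Y := ⟨takeuchiMul ι X Y.1, fun r => by
    have h1 := tensorHom_takeuchiMul ι X 1 (ι (sE k r)) Y.1
    have h2 := tensorHom_takeuchiMul ι X (ι (tE k r)) 1 Y.1
    rw [rmul_one, id_tensorHom] at h1
    rw [rmul_one, tensorHom_id] at h2
    rw [h1, h2, Y.2 r]⟩

theorem takeuchi_mul_val (X Y : takeuchi ι) : (X * Y).1 = takeuchiMul ι X Y.1 := rfl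

/-- The unit `1 ⊗ 1` of `A ×_R A`. -/
instance : One (takeuchi ι) where
  one := ⟨tmul (toBimod ι 1) (toBimod ι 1), fun r => by
    rw [whiskerLeft_tmul, whiskerRight_tmul, rmul_apply, rmul_apply]
    have h := tmul_bal r (toBimod ι 1) (toBimod ι 1)
    rw [smul_bimodOf, smul_bimodOf] at h
    change tmul (toBimod ι 1) (toBimod ι (1 * ι (sE k r))) =
      tmul (toBimod ι (1 * ι (tE k r))) (toBimod ι 1)
    change tmul (toBimod ι (ι (tE k r) * 1)) (toBimod ι 1) =
      tmul (toBimod ι 1) (toBimod ι (ι (sE k r) * 1)) at h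
    rw [mul_one, mul_one] at h
    rw [one_mul, one_mul, h]⟩

theorem takeuchi_one_val : (1 : takeuchi ι).1 = tmul (toBimod ι 1) (toBimod ι 1) := rfl

end Takeuchi

/-- A left bialgebroid (Takeuchi `×_R`-bialgebra) over the `k`-algebra `R`. -/
structure LeftBialgebroid (k : Type w) (R : Type u) [CommRing k] [Ring R] [Algebra k R] where
  /-- the total algebra -/
  A : Type u
  [ring : Ring A]
  [algebra : Algebra k A]
  /-- the algebra map `s ⊗ t : R ⊗ Rᵒᵖ → A` -/
  ι : Env k R →ₐ[k] A
  /-- the comonoid structure `(A, Δ, ε)` in the monoidal category of `R`-`R`-bimodules -/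
  comon : ComonObj (bimodOf ι)
  /-- the image of `Δ` lies in `A ×_R A` -/
  comul_mem (a : A) : comon.comul.hom (toBimod ι a) ∈ takeuchi ι
  /-- `Δ : A → A ×_R A` preserves the unit -/
  comul_one : (⟨comon.comul.hom (toBimod ι 1), comul_mem 1⟩ : takeuchi ι) = 1
  /-- `Δ : A → A ×_R A` is multiplicative -/
  comul_mul (a b : A) : (⟨comon.comul.hom (toBimod ι (a * b)), comul_mem (a * b)⟩ : takeuchi ι) =
    ⟨comon.comul.hom (toBimod ι a), comul_mem a⟩ * ⟨comon.comul.hom (toBimod ι b), comul_mem b⟩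
  /-- `ε(1) = 1` -/
  counit_one : ofUnit (comon.counit.hom (toBimod ι 1)) = 1
  /-- `ε(a s(ε(b))) = ε(a b)` -/
  counit_mul_s (a b : A) : ofUnit (comon.counit.hom (toBimod ι
      (a * ι (sE k (ofUnit (comon.counit.hom (toBimod ι b))))))) =
    ofUnit (comon.counit.hom (toBimod ι (a * b)))
  /-- `ε(a t(ε(b))) = ε(a b)` -/
  counit_mul_t (a b : A) : ofUnit (comon.counit.hom (toBimod ι
      (a * ι (tE k (ofUnit (comon.counit.hom (toBimod ι b))))))) =
    ofUnit (comon.counit.hom (toBimod ι (a * b)))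

attribute [instance] LeftBialgebroid.ring LeftBialgebroid.algebra

/-! ### The functor `A ⊗_{R^e} -` -/

section Induction

variable {k : Type w} {R : Type u} [CommRing k] [Ring R] [Algebra k R]
variable {A : Type u} [Ring A] [Algebra k A] (ι : Env k R →ₐ[k] A)

/-- The additive group `A ⊗_{R^e} X`: here `a·e ⊗ x = a ⊗ e·x` where `a·e = a ι(e)`. -/
abbrev IndTens (X : BimodCat k R) : Type u :=
  Balanced (S := Env k R) (fun e (a : A) => a * ι e) (fun e (x : X) => e • x)

/-- The pure tensor `a ⊗ x` in `A ⊗_{R^e} X`, as a biadditive map. -/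
abbrev indMk (X : BimodCat k R) : A →+ X →+ IndTens ι X :=
  Balanced.mk (S := Env k R) (fun e (a : A) => a * ι e) (fun e (x : X) => e • x)

theorem indMk_bal {X : BimodCat k R} (e : Env k R) (a : A) (x : X) :
    indMk ι X (a * ι e) x = indMk ι X a (e • x) :=
  Balanced.mk_balanced (ρ := fun e (a : A) => a * ι e) (l := fun e (x : X) => e • x) e a x

/-- Left multiplication `b·(a ⊗ x) = b a ⊗ x` on `A ⊗_{R^e} X`. -/
def indAct (X : BimodCat k R) : A →+ (IndTens ι X →+ IndTens ι X) :=
  AddMonoidHom.mk'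
    (fun b => Balanced.lift
      (biadd (fun a x => indMk ι X (b * a) x)
        (fun a a' x => by rw [mul_add, map_add, AddMonoidHom.add_apply])
        (fun a x x' => map_add _ x x'))
      (fun e a x => by
        change indMk ι X (b * (a * ι e)) x = indMk ι X (b * a) (e • x)
        rw [← mul_assoc, indMk_bal]))
    (fun b b' => by
      apply Balanced.addHom_ext
      intro a x
      change indMk ι X ((b + b') * a) x = indMk ι X (b * a) x + indMk ι X (b' * a) x
      rw [add_mul, map_add, AddMonoidHom.add_apply])

theorem indAct_mk (X : BimodCat k R) (b a : A) (x : X) :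
    indAct ι X b (indMk ι X a x) = indMk ι X (b * a) x := rfl

theorem indAct_one (X : BimodCat k R) (z : IndTens ι X) : indAct ι X 1 z = z := by
  induction z using Balanced.induction with
  | hm a x => exact congrArg (fun b => indMk ι X b x) (one_mul a)
  | ha a b ha hb => rw [map_add, ha, hb]

theorem indAct_mul (X : BimodCat k R) (b c : A) (z : IndTens ι X) :
    indAct ι X (b * c) z = indAct ι X b (indAct ι X c z) := by
  induction z using Balanced.induction with
  | hm a x => exact congrArg (fun b => indMk ι X b x) (mul_assoc b c a)
  | ha a b ha hb => rw [map_add, map_add, map_add, ha, hb]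

/-- The `R^e`-module structure `e·(a ⊗ x) = ι(e) a ⊗ x` on `A ⊗_{R^e} X`. -/
@[reducible]
def indModule (X : BimodCat k R) : Module (Env k R) (IndTens ι X) where
  smul e z := indAct ι X (ι e) z
  one_smul z := by
    change indAct ι X (ι 1) z = z
    rw [map_one, indAct_one]
  mul_smul e f z := by
    change indAct ι X (ι (e * f)) z = indAct ι X (ι e) (indAct ι X (ι f) z)
    rw [map_mul, indAct_mul]
  smul_zero e := map_zero _
  smul_add e := map_add _
  add_smul e f z := by
    change indAct ι X (ι (e + f)) z = indAct ι X (ι e) z + indAct ι X (ι f) z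
    rw [map_add, map_add, AddMonoidHom.add_apply]
  zero_smul z := by
    change indAct ι X (ι 0) z = 0
    rw [map_zero, map_zero, AddMonoidHom.zero_apply]

/-- The bimodule `A ⊗_{R^e} X`. -/
def indObj (X : BimodCat k R) : BimodCat k R :=
  @ModuleCat.of (Env k R) _ (IndTens ι X) _ (indModule ι X)

variable {X Y Z : BimodCat k R}

/-- The pure tensor `a ⊗ x` in `A ⊗_{R^e} X`. -/
def itmul (a : A) (x : X) : indObj ι X := indMk ι X a x

theorem itmul_add_left (a a' : A) (x : X) : itmul ι (a + a') x = itmul ι a x + itmul ι a' x := by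
  change indMk ι X (a + a') x = indMk ι X a x + indMk ι X a' x
  rw [map_add, AddMonoidHom.add_apply]

theorem itmul_add_right (a : A) (x x' : X) : itmul ι a (x + x') = itmul ι a x + itmul ι a x' :=
  map_add (indMk ι X a) x x'

theorem itmul_bal (e : Env k R) (a : A) (x : X) : itmul ι (a * ι e) x = itmul ι a (e • x) :=
  indMk_bal ι e a x

theorem smul_itmul (e : Env k R) (a : A) (x : X) : e • itmul ι a x = itmul ι (ι e * a) x := rfl

theorem itmul_induction {p : indObj ι X → Prop} (z : indObj ι X)
    (hm : ∀ a x, p (itmul ι a x)) (ha : ∀ a b, p a → p b → p (a + b)) : p z :=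
  Balanced.induction (p := p) z hm ha

/-- The bimodule morphism `a ↦ a ⊗ x` from `A` to `A ⊗_{R^e} X`. -/
def into (x : X) : bimodOf ι ⟶ indObj ι X :=
  linHom
    { toFun := fun a => itmul ι (ofBimod ι a) x
      map_add' := fun a a' => itmul_add_left ι (ofBimod ι a) (ofBimod ι a') x
      map_smul' := fun _ _ => rfl }

theorem into_apply (x : X) (a : bimodOf ι) : (into ι x).hom a = itmul ι (ofBimod ι a) x := rfl

theorem into_add (x x' : X) : into ι (x + x') = into ι x + into ι x' := by
  ext a
  exact itmul_add_right ι (ofBimod ι a) x x'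

theorem into_smul (e : Env k R) (x : X) : into ι (e • x) = rmul ι (ι e) ≫ into ι x := by
  ext a
  exact (itmul_bal ι e (ofBimod ι a) x).symm

theorem ind_hom_ext {f g : indObj ι X ⟶ Z} (h : ∀ x : X, into ι x ≫ f = into ι x ≫ g) :
    f = g := by
  ext z
  induction z using itmul_induction with
  | hm a x => exact congrArg (fun q => q.hom (toBimod ι a)) (h x)
  | ha a b ha hb => rw [map_add, map_add, ha, hb]

theorem ind_tensor_hom_ext {f g : indObj ι (X ⊗ Y) ⟶ Z}
    (h : ∀ (x : X) (y : Y), into ι (tmul x y) ≫ f = into ι (tmul x y) ≫ g) : f = g := by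
  apply ind_hom_ext
  intro z
  induction z using tmul_induction with
  | hm x y => exact h x y
  | ha a b ha hb => rw [into_add, Preadditive.add_comp, Preadditive.add_comp, ha, hb]

/-- The bimodule morphism `a ⊗ x ↦ φ x a` out of `A ⊗_{R^e} X`. -/
def indDesc (φ : X →+ (bimodOf ι ⟶ Z)) (hφ : ∀ (e : Env k R) x, φ (e • x) = rmul ι (ι e) ≫ φ x) :
    indObj ι X ⟶ Z :=
  linHom
    { toFun := Balanced.lift
        (biadd (fun (a : A) (x : X) => (φ x).hom (toBimod ι a))
          (fun a a' x => map_add (φ x).hom (toBimod ι a) (toBimod ι a'))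
          (fun a x x' => by rw [map_add]; rfl))
        (fun e a x => by
          change (φ x).hom (toBimod ι (a * ι e)) = (φ (e • x)).hom (toBimod ι a)
          rw [hφ]; rfl)
      map_add' := map_add _
      map_smul' := fun e z => by
        induction z using itmul_induction with
        | hm a x => exact map_smul (φ x).hom e (toBimod ι a)
        | ha a b ha hb =>
          rw [smul_add]
          refine (map_add (Balanced.lift _ _) _ _).trans ?_
          refine (congrArg₂ (· + ·) ha hb).trans ?_
          rw [← smul_add]
          exact congrArg (e • ·) (map_add (Balanced.lift _ _) _ _).symm }

theorem into_indDesc (φ : X →+ (bimodOf ι ⟶ Z)) (hφ) (x : X) :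
    into ι x ≫ indDesc ι φ hφ = φ x := rfl

/-- The map `a ⊗ x ↦ a ⊗ f x`. -/
def indMap (f : X ⟶ Y) : indObj ι X ⟶ indObj ι Y :=
  indDesc ι (AddMonoidHom.mk' (fun x => into ι (f.hom x))
      (fun x x' => by rw [map_add, into_add]))
    (fun e x => by
      change into ι (f.hom (e • x)) = rmul ι (ι e) ≫ into ι (f.hom x)
      rw [map_smul, into_smul])

theorem into_indMap (f : X ⟶ Y) (x : X) : into ι x ≫ indMap ι f = into ι (f.hom x) := rfl

/-- The endofunctor `A ⊗_{R^e} -` of the category of `R`-`R`-bimodules. -/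
def indFunctor : BimodCat k R ⥤ BimodCat k R where
  obj X := indObj ι X
  map f := indMap ι f
  map_id _ := ind_hom_ext ι fun _ => rfl
  map_comp _ _ := ind_hom_ext ι fun _ => rfl

/-- The unit `x ↦ 1 ⊗ x`. -/
def indUnit (X : BimodCat k R) : X ⟶ indObj ι X :=
  linHom
    { toFun := fun x => itmul ι 1 x
      map_add' := fun x x' => itmul_add_right ι 1 x x'
      map_smul' := fun e x => by
        rw [← itmul_bal, one_mul, RingHom.id_apply, smul_itmul, mul_one] }

theorem indUnit_apply (x : X) : (indUnit ι X).hom x = itmul ι 1 x := rfl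

/-- The map `a ↦ a·z` from `A` to `A ⊗_{R^e} X`, where `a·(b ⊗ x) = a b ⊗ x`. -/
def orbit (z : indObj ι X) : bimodOf ι ⟶ indObj ι X :=
  linHom
    { toFun := fun a => indAct ι X (ofBimod ι a) z
      map_add' := fun a a' => DFunLike.congr_fun
        (map_add (indAct ι X) (ofBimod ι a) (ofBimod ι a')) z
      map_smul' := fun e a => indAct_mul ι X (ι e) (ofBimod ι a) z }

theorem orbit_itmul (b : A) (x : X) : orbit ι (itmul ι b x) = rmul ι b ≫ into ι x := rfl

/-- The multiplication `a ⊗ (b ⊗ x) ↦ a b ⊗ x`. -/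
def indMul (X : BimodCat k R) : indObj ι (indObj ι X) ⟶ indObj ι X :=
  indDesc ι (AddMonoidHom.mk' (fun z => orbit ι z) (fun z z' => by
      ext a
      exact map_add (indAct ι X (ofBimod ι a)) z z'))
    (fun e z => by
      ext a
      exact (indAct_mul ι X (ofBimod ι a) (ι e) z).symm)

theorem into_indMul (z : indObj ι X) : into ι z ≫ indMul ι X = orbit ι z := rfl

theorem indMul_itmul (a b : A) (x : X) :
    (indMul ι X).hom (itmul ι a (itmul ι b x)) = itmul ι (a * b) x := rfl

theorem orbit_add (z z' : indObj ι X) : orbit ι (z + z') = orbit ι z + orbit ι z' := by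
  ext a
  exact map_add (indAct ι X (ofBimod ι a)) z z'

theorem orbit_indMap (f : X ⟶ Y) (z : indObj ι X) :
    orbit ι z ≫ indMap ι f = orbit ι ((indMap ι f).hom z) := by
  induction z using itmul_induction with
  | hm b x => rfl
  | ha b c hb hc => rw [map_add, orbit_add, orbit_add, Preadditive.add_comp, hb, hc]

theorem orbit_indMul (z : indObj ι (indObj ι X)) :
    orbit ι z ≫ indMul ι X = orbit ι ((indMul ι X).hom z) := by
  induction z using itmul_induction with
  | hm b y =>
    ext a
    exact indAct_mul ι X (ofBimod ι a) b y
  | ha b c hb hc => rw [map_add, orbit_add, orbit_add, Preadditive.add_comp, hb, hc]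

/-- The monad `A ⊗_{R^e} -`. -/
def indMonad : Monad (BimodCat k R) where
  toFunctor := indFunctor ι
  η := { app := fun X => indUnit ι X }
  μ :=
    { app := fun X => indMul ι X
      naturality := fun _ _ f => ind_hom_ext ι fun z => (orbit_indMap ι f z).symm }
  assoc _ := ind_hom_ext ι fun z => (orbit_indMul ι z).symm
  left_unit X := by
    apply ModuleCat.hom_ext
    apply LinearMap.ext
    intro z
    exact indAct_one ι X z
  right_unit X := ind_hom_ext ι fun x => by
    ext a
    exact congrArg (fun b => itmul ι b x) (mul_one (ofBimod ι a))

end Induction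

/-! ### The bimonad of a left bialgebroid -/

namespace LeftBialgebroid

variable {k : Type w} {R : Type u} [CommRing k] [Ring R] [Algebra k R]
variable (B : LeftBialgebroid k R) {X Y Z : BimodCat k R}

/-- The comultiplication `Δ : A ⟶ A ⊗_R A`. -/
def comul : bimodOf B.ι ⟶ bimodOf B.ι ⊗ bimodOf B.ι := B.comon.comul

/-- The counit `ε : A ⟶ R`. -/
def counit : bimodOf B.ι ⟶ 𝟙_ (BimodCat k R) := B.comon.counit

/-- The comultiplication as a map to the Takeuchi product. -/
def comulT (a : B.A) : takeuchi B.ι := ⟨B.comul.hom (toBimod B.ι a), B.comul_mem a⟩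

theorem comul_takeuchi (r : R) :
    B.comul ≫ bimodOf B.ι ◁ rmul B.ι (B.ι (sE k r)) =
      B.comul ≫ rmul B.ι (B.ι (tE k r)) ▷ bimodOf B.ι := by
  ext a
  exact B.comul_mem a r

theorem comul_one' :
    B.comul.hom (toBimod B.ι 1) = tmul (toBimod B.ι 1) (toBimod B.ι 1) :=
  congrArg Subtype.val B.comul_one

theorem comul_mul' (a b : B.A) : B.comul.hom (toBimod B.ι (a * b)) =
    takeuchiMul B.ι (B.comulT a) (B.comul.hom (toBimod B.ι b)) :=
  congrArg Subtype.val (B.comul_mul a b)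

theorem comul_sE_tE (r r' : R) : B.comul.hom (toBimod B.ι (B.ι (sE k r * tE k r'))) =
    tmul (toBimod B.ι (B.ι (sE k r))) (toBimod B.ι (B.ι (tE k r'))) := by
  have h : toBimod B.ι (B.ι (sE k r * tE k r')) = (sE k r * tE k r') • toBimod B.ι 1 := by
    rw [smul_bimodOf]
    exact congrArg (toBimod B.ι) (mul_one _).symm
  rw [h, map_smul, comul_one', mul_smul, tE_tmul, sE_tmul, smul_bimodOf, smul_bimodOf]
  change tmul (toBimod B.ι (B.ι (sE k r) * 1)) (toBimod B.ι (B.ι (tE k r') * 1)) = _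
  rw [mul_one, mul_one]

theorem rmul_comul (r r' : R) : rmul B.ι (B.ι (sE k r * tE k r')) ≫ B.comul =
    B.comul ≫ (rmul B.ι (B.ι (sE k r)) ⊗ₘ rmul B.ι (B.ι (tE k r'))) := by
  ext a
  have h := B.comul_mul' (ofBimod B.ι a) (B.ι (sE k r * tE k r'))
  rw [comul_sE_tE, takeuchiMul_tmul] at h
  exact h

theorem comul_assoc_assoc {W : BimodCat k R}
    (h : bimodOf B.ι ⊗ bimodOf B.ι ⊗ bimodOf B.ι ⟶ W) :
    B.comul ≫ bimodOf B.ι ◁ B.comul ≫ h =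
      B.comul ≫ B.comul ▷ bimodOf B.ι ≫
        (α_ (bimodOf B.ι) (bimodOf B.ι) (bimodOf B.ι)).hom ≫ h := by
  let _ := B.comon
  exact ComonObj.comul_assoc_assoc (bimodOf B.ι) h

/-- The additive map `x ⊗ y ↦ (a ↦ ∑ (a₍₁₎ ⊗ x) ⊗ (a₍₂₎ ⊗ y))`. -/
def gammaAux (X Y : BimodCat k R) :
    (X ⊗ Y : BimodCat k R) →+ (bimodOf B.ι ⟶ indObj B.ι X ⊗ indObj B.ι Y) :=
  tensorLift
    (biadd (fun x y => B.comul ≫ (into B.ι x ⊗ₘ into B.ι y))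
      (fun x x' y => by rw [into_add, tensorHom_add_left, Preadditive.comp_add])
      (fun x y y' => by rw [into_add, tensorHom_add_right, Preadditive.comp_add]))
    (fun r x y => by
      change B.comul ≫ (into B.ι (tE k r • x) ⊗ₘ into B.ι y) =
        B.comul ≫ (into B.ι x ⊗ₘ into B.ι (sE k r • y))
      rw [into_smul, into_smul, ← whiskerRight_comp_tensorHom, ← whiskerLeft_comp_tensorHom,
        ← Category.assoc, ← Category.assoc, comul_takeuchi])

theorem gammaAux_tmul (x : X) (y : Y) :
    B.gammaAux X Y (tmul x y) = B.comul ≫ (into B.ι x ⊗ₘ into B.ι y) := rfl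

/-- The map `a ⊗ (x ⊗ y) ↦ ∑ (a₍₁₎ ⊗ x) ⊗ (a₍₂₎ ⊗ y)`. -/
def gamma (X Y : BimodCat k R) : indObj B.ι (X ⊗ Y) ⟶ indObj B.ι X ⊗ indObj B.ι Y :=
  indDesc B.ι (B.gammaAux X Y) (fun e z => by
    induction z using tmul_induction with
    | ha a b ha hb => rw [smul_add, map_add, map_add, ha, hb, Preadditive.comp_add]
    | hm x y =>
      induction e using env_induction with
      | ha a b ha hb => rw [add_smul, map_add, ha, hb, map_add, rmul_add, Preadditive.add_comp]
      | hm r r' =>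
        rw [gammaAux_tmul, ← Category.assoc, rmul_comul, mul_smul, tE_tmul, sE_tmul,
          gammaAux_tmul, into_smul, into_smul, ← tensorHom_comp_tensorHom, Category.assoc])

theorem into_gamma (x : X) (y : Y) :
    into B.ι (tmul x y) ≫ B.gamma X Y = B.comul ≫ (into B.ι x ⊗ₘ into B.ι y) := rfl

theorem into_gamma' (z : (X ⊗ Y : BimodCat k R)) :
    into B.ι z ≫ B.gamma X Y = B.gammaAux X Y z := rfl

theorem counit_one' : B.counit.hom (toBimod B.ι 1) = toUnit 1 := B.counit_one

theorem counit_sE (r : R) : B.counit.hom (toBimod B.ι (B.ι (sE k r))) = toUnit r := by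
  have h : toBimod B.ι (B.ι (sE k r)) = sE k r • toBimod B.ι 1 := by
    rw [smul_bimodOf]
    exact congrArg (toBimod B.ι) (mul_one _).symm
  rw [h, map_smul, counit_one']
  exact (sE_unit r (toUnit 1)).trans (congrArg toUnit (mul_one r))

theorem counit_mul_sE (a b : B.A) : B.counit.hom (toBimod B.ι
      (a * B.ι (sE k (ofUnit (B.counit.hom (toBimod B.ι b)))))) =
    B.counit.hom (toBimod B.ι (a * b)) := B.counit_mul_s a b

theorem counit_mul_tE (a b : B.A) : B.counit.hom (toBimod B.ι
      (a * B.ι (tE k (ofUnit (B.counit.hom (toBimod B.ι b)))))) =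
    B.counit.hom (toBimod B.ι (a * b)) := B.counit_mul_t a b

theorem counit_sE_eq_tE (r : R) :
    rmul B.ι (B.ι (tE k r)) ≫ B.counit = rmul B.ι (B.ι (sE k r)) ≫ B.counit := by
  ext a
  have h := B.counit_mul_tE (ofBimod B.ι a) (B.ι (sE k r))
  rw [counit_sE] at h
  exact h

/-- The map `a ⊗ r ↦ ε(a s(r))`. -/
def counitMap : indObj B.ι (𝟙_ (BimodCat k R)) ⟶ 𝟙_ (BimodCat k R) :=
  indDesc (X := 𝟙_ (BimodCat k R)) B.ι
    (AddMonoidHom.mk' (fun r => rmul B.ι (B.ι (sE k (ofUnit r))) ≫ B.counit)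
      (fun r r' => by
        change rmul B.ι (B.ι (sE k (ofUnit r + ofUnit r'))) ≫ B.counit = _
        rw [sE_add, map_add, rmul_add, Preadditive.add_comp]))
    (fun e r => by
      change rmul B.ι (B.ι (sE k (ofUnit (e • r)))) ≫ B.counit =
        rmul B.ι (B.ι e) ≫ rmul B.ι (B.ι (sE k (ofUnit r))) ≫ B.counit
      induction e using env_induction with
      | ha a b ha hb =>
        rw [add_smul]
        change rmul B.ι (B.ι (sE k (ofUnit (a • r) + ofUnit (b • r)))) ≫ B.counit = _
        rw [sE_add, map_add, rmul_add, Preadditive.add_comp, ha, hb, map_add, rmul_add,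
          Preadditive.add_comp]
      | hm p q =>
        rw [mul_smul]
        have h : sE k p • tE k q • r = toUnit (p * (ofUnit r * q)) := by
          refine Eq.trans (congrArg (sE k p • ·) (tE_unit q r)) ?_
          exact sE_unit p (toUnit (ofUnit r * q))
        rw [h]
        change rmul B.ι (B.ι (sE k (p * (ofUnit r * q)))) ≫ B.counit = _
        have e1 : sE k p * tE k q * sE k (ofUnit r) = sE k (p * ofUnit r) * tE k q := by
          rw [mul_assoc, ← sE_tE_comm, ← mul_assoc, sE_mul]
        rw [← Category.assoc, rmul_comp, ← map_mul, e1, map_mul, ← rmul_comp, Category.assoc,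
          counit_sE_eq_tE, ← Category.assoc, rmul_comp, ← map_mul, ← sE_mul, mul_assoc])

theorem into_counitMap (r : R) : into B.ι (X := 𝟙_ (BimodCat k R)) (toUnit r) ≫ B.counitMap =
    rmul B.ι (B.ι (sE k r)) ≫ B.counit := rfl

theorem into_one_counitMap :
    into B.ι (X := 𝟙_ (BimodCat k R)) (toUnit 1) ≫ B.counitMap = B.counit := by
  rw [into_counitMap, sE_one, map_one, rmul_one, Category.id_comp]

/-- The lax comonoidal structure `(γ, π)` on `A ⊗_{R^e} -`. -/
@[reducible]
def comonoidal : (indFunctor B.ι).OplaxMonoidal where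
  η := B.counitMap
  δ := B.gamma
  δ_natural_left f X' := ind_tensor_hom_ext B.ι fun x y => by
    change B.comul ≫ (into B.ι x ⊗ₘ into B.ι y) ≫ indMap B.ι f ▷ indObj B.ι X' =
      B.comul ≫ (into B.ι (f.hom x) ⊗ₘ into B.ι y)
    rw [tensorHom_comp_whiskerRight, into_indMap]
  δ_natural_right X' f := ind_tensor_hom_ext B.ι fun x y => by
    change B.comul ≫ (into B.ι x ⊗ₘ into B.ι y) ≫ indObj B.ι X' ◁ indMap B.ι f =
      B.comul ≫ (into B.ι x ⊗ₘ into B.ι (f.hom y))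
    rw [tensorHom_comp_whiskerLeft, into_indMap]
  oplax_associativity X Y Z := by
    apply ind_tensor_hom_ext
    intro t z
    change B.comul ≫ (into B.ι t ⊗ₘ into B.ι z) ≫ B.gamma X Y ▷ indObj B.ι Z ≫
        (α_ (indObj B.ι X) (indObj B.ι Y) (indObj B.ι Z)).hom =
      B.gammaAux X (Y ⊗ Z) ((α_ X Y Z).hom.hom (tmul t z)) ≫ indObj B.ι X ◁ B.gamma Y Z
    induction t using tmul_induction with
    | ha a b ha hb =>
      rw [tmul_add_left, map_add, map_add, Preadditive.add_comp, ← ha, ← hb, into_add,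
        tensorHom_add_left, Preadditive.add_comp, Preadditive.comp_add]
    | hm x y =>
      rw [associator_tmul, gammaAux_tmul, tensorHom_comp_whiskerRight_assoc, into_gamma,
        Category.assoc, tensorHom_comp_whiskerLeft, into_gamma,
        ← whiskerRight_comp_tensorHom_assoc, ← whiskerLeft_comp_tensorHom, associator_naturality,
        B.comul_assoc_assoc]
  oplax_left_unitality X := ind_hom_ext B.ι fun x => by
    change into B.ι x ≫ (λ_ (indObj B.ι X)).inv =
      B.comul ≫ (into B.ι (X := 𝟙_ (BimodCat k R)) (toUnit 1) ⊗ₘ into B.ι x) ≫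
        B.counitMap ▷ indObj B.ι X
    rw [tensorHom_comp_whiskerRight, into_one_counitMap]
    let _ := B.comon
    exact (ComonObj.counit_comul_hom (into B.ι x)).symm
  oplax_right_unitality X := ind_hom_ext B.ι fun x => by
    change into B.ι x ≫ (ρ_ (indObj B.ι X)).inv =
      B.comul ≫ (into B.ι x ⊗ₘ into B.ι (X := 𝟙_ (BimodCat k R)) (toUnit 1)) ≫
        indObj B.ι X ◁ B.counitMap
    rw [tensorHom_comp_whiskerLeft, into_one_counitMap]
    let _ := B.comon
    exact (ComonObj.comul_counit_hom (into B.ι x)).symm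

theorem gammaAux_mul (x : X) (y : Y) (w : (bimodOf B.ι ⊗ bimodOf B.ι : BimodCat k R)) (a : B.A) :
    (B.gammaAux (indObj B.ι X) (indObj B.ι Y) ((into B.ι x ⊗ₘ into B.ι y).hom w) ≫
        (indMul B.ι X ⊗ₘ indMul B.ι Y)).hom (toBimod B.ι a) =
      (into B.ι x ⊗ₘ into B.ι y).hom (takeuchiMul B.ι (B.comulT a) w) := by
  induction w using tmul_induction with
  | hm c d =>
    rw [tensorHom_tmul, gammaAux_tmul, Category.assoc, tensorHom_comp_tensorHom, takeuchiMul_tmul,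
      ← ModuleCat.comp_apply, tensorHom_comp_tensorHom]
    rfl
  | ha a b ha hb =>
    rw [map_add, map_add, map_add, Preadditive.add_comp, map_add, ← ha, ← hb]
    rfl

theorem orbit_gamma (z : indObj B.ι (X ⊗ Y)) : orbit B.ι z ≫ B.gamma X Y =
    B.gammaAux (indObj B.ι X) (indObj B.ι Y) ((B.gamma X Y).hom z) ≫
      (indMul B.ι X ⊗ₘ indMul B.ι Y) := by
  induction z using itmul_induction with
  | ha a b ha hb =>
    rw [orbit_add, map_add, map_add, Preadditive.add_comp, Preadditive.add_comp, ha, hb]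
  | hm b t =>
    induction t using tmul_induction with
    | ha x y hx hy =>
      rw [itmul_add_right, orbit_add, map_add, map_add, Preadditive.add_comp,
        Preadditive.add_comp, hx, hy]
    | hm x y =>
      ext a
      have h1 : (B.gamma X Y).hom (itmul B.ι b (tmul x y)) =
        (into B.ι x ⊗ₘ into B.ι y).hom (B.comul.hom (toBimod B.ι b)) := rfl
      rw [h1]
      refine Eq.trans ?_ (B.gammaAux_mul x y _ (ofBimod B.ι a)).symm
      rw [← comul_mul']
      rfl

/-- The bimonad `A ⊗_{R^e} -` of a left bialgebroid `A` over `R`, with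
`μ (a ⊗ (b ⊗ x)) = a b ⊗ x`, `η x = 1 ⊗ x`,
`γ (a ⊗ (x ⊗ y)) = ∑ (a₍₁₎ ⊗ x) ⊗ (a₍₂₎ ⊗ y)` and `π (a ⊗ r) = ε(a s(r))`. -/
def bimonad : Bimonad (BimodCat k R) where
  monad := indMonad B.ι
  comonoidal := B.comonoidal
  mu_comul _ _ := ind_hom_ext B.ι fun z => B.orbit_gamma z
  mu_counit := by
    apply ind_hom_ext
    intro z
    change orbit B.ι z ≫ B.counitMap =
      rmul B.ι (B.ι (sE k (ofUnit (B.counitMap.hom z)))) ≫ B.counit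
    induction z using itmul_induction with
    | ha a b ha hb =>
      rw [orbit_add, Preadditive.add_comp, ha, hb, map_add]
      change _ = rmul B.ι (B.ι (sE k (ofUnit _ + ofUnit _))) ≫ B.counit
      rw [sE_add, map_add, rmul_add, Preadditive.add_comp]
    | hm b r =>
      ext a
      have h := B.counit_mul_sE (ofBimod B.ι a) (b * B.ι (sE k (ofUnit r)))
      rw [← mul_assoc] at h
      exact h.symm
  eta_comul _ _ := tensor_hom_ext fun x y => by
    change (into B.ι x ⊗ₘ into B.ι y).hom (B.comul.hom (toBimod B.ι 1)) =
      tmul (itmul B.ι 1 x) (itmul B.ι 1 y)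
    rw [comul_one']
    rfl
  eta_counit := by
    apply ModuleCat.hom_ext
    apply LinearMap.ext
    intro r
    have h := B.counit_sE (ofUnit r)
    rw [← one_mul (B.ι (sE k (ofUnit r)))] at h
    exact h

/-! The defining formulas of the bimonad of a bialgebroid, on elements. -/

theorem bimonad_mu (a b : B.A) (x : X) :
    (B.bimonad.monad.μ.app X).hom (itmul B.ι a (itmul B.ι b x)) = itmul B.ι (a * b) x := rfl

theorem bimonad_eta (x : X) : (B.bimonad.monad.η.app X).hom x = itmul B.ι 1 x := rfl

theorem bimonad_gamma (a : B.A) (x : X) (y : Y) :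
    (B.bimonad.comonoidal.δ X Y).hom (itmul B.ι a (tmul x y)) =
      (into B.ι x ⊗ₘ into B.ι y).hom (B.comul.hom (toBimod B.ι a)) := rfl

theorem bimonad_pi (a : B.A) (r : R) :
    B.bimonad.comonoidal.η.hom (itmul (X := 𝟙_ (BimodCat k R)) B.ι a (toUnit r)) =
      B.counit.hom (toBimod B.ι (a * B.ι (sE k r))) := rfl

end LeftBialgebroid

section Linear

open scoped ModuleCat.Algebra

/-- An endofunctor `T` of the category of `R`-`R`-bimodules is `k`-linear if the maps
`Hom(X, Y) → Hom(T X, T Y)` are `k`-linear. -/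
structure IsKLinear {k : Type w} {R : Type u} [CommRing k] [Ring R] [Algebra k R]
    (T : BimodCat k R ⥤ BimodCat k R) : Prop where
  additive : T.Additive
  linear : T.Linear k

end Linear

end Bimonads

end

/-!
The proof is of Eilenberg–Watts type. The functor `A ⊗_{R^e} -` always has the right adjoint
`Hom(A, -)` (`indCoindAdjunction`), which gives one direction.

For the other direction, let `T` be a `k`-linear bimonad and let `A = T(R^e)`. An element `x` of a
bimodule `X` is the same as a morphism `pt x : R^e ⟶ X`. Endomorphisms of `R^e` in the Kleisli
category of `T` are the elements of `A`, so `A` is a ring: right multiplication by `b` is the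
Kleisli extension `kl b` of `pt b`. The unit of `T` is a ring map `R^e → A`, and it makes `A` a
`k`-algebra because `T` is `k`-linear. The bimodule `R^e` is a comonoid in which `1 ⊗ 1` is
grouplike, and the oplax monoidal functor `T` carries it to a comonoid structure on `A`. The
bialgebroid axioms for `A` are then the compatibilities of `μ` and `η` with the comonoidal structure
of `T`, evaluated at `R^e`; the main point is `bialgComul_mul`.

The comparison `A ⊗_{R^e} X ⟶ T X`, `a ⊗ x ↦ T(pt x)(a)`, respects all the structure of a bimonad
for every `k`-linear `T`. When `T` has a right adjoint `G`, the elements of `G Y` correspond to the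
morphisms `R^e ⟶ G Y`, hence to the morphisms `A ⟶ Y`, so `G` is isomorphic to `Hom(A, -)` and the
comparison is an isomorphism by the Yoneda lemma (`isIso_comparison`). No presentation of `X` by
free bimodules is needed.
-/

noncomputable section

namespace Bimonads

open BimodCat

variable {k : Type w} {R : Type u} [CommRing k] [Ring R] [Algebra k R]

/-! ### The right adjoint of an induction functor -/

section Coinduction

variable {A : Type u} [Ring A] [Algebra k A] (ι : Env k R →ₐ[k] A)

/-- The `R^e`-module structure `(e·f)(a) = f(a ι(e))` on `Hom(A, Y)`. -/
@[reducible]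
def coindModule (Y : BimodCat k R) : Module (Env k R) (bimodOf ι ⟶ Y) where
  smul e f := rmul ι (ι e) ≫ f
  one_smul f := by
    change rmul ι (ι 1) ≫ f = f
    rw [map_one, rmul_one, Category.id_comp]
  mul_smul e e' f := by
    change rmul ι (ι (e * e')) ≫ f = rmul ι (ι e) ≫ rmul ι (ι e') ≫ f
    rw [map_mul, ← rmul_comp, Category.assoc]
  smul_zero e := Limits.comp_zero
  smul_add e f g := Preadditive.comp_add _ _ _ _ f g
  add_smul e e' f := by
    change rmul ι (ι (e + e')) ≫ f = rmul ι (ι e) ≫ f + rmul ι (ι e') ≫ f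
    rw [map_add, rmul_add, Preadditive.add_comp]
  zero_smul f := by
    change rmul ι (ι 0) ≫ f = 0
    have h : rmul ι (ι 0) = 0 := by
      ext a
      exact (congrArg (fun b => ofBimod ι a * b) (map_zero ι)).trans (mul_zero _)
    rw [h, Limits.zero_comp]

/-- The bimodule `Hom(A, Y)` of bimodule morphisms from `A` to `Y`, with `(e·f)(a) = f(a ι(e))`. -/
def coindObj (Y : BimodCat k R) : BimodCat k R :=
  @ModuleCat.of (Env k R) _ (bimodOf ι ⟶ Y) _ (coindModule ι Y)

variable {X Y Z : BimodCat k R}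

/-- A morphism from `A` to `Y`, regarded as an element of the bimodule `Hom(A, Y)`. -/
def toCoind (f : bimodOf ι ⟶ Y) : coindObj ι Y := f

/-- An element of the bimodule `Hom(A, Y)`, regarded as a morphism from `A` to `Y`. -/
def ofCoind (f : coindObj ι Y) : bimodOf ι ⟶ Y := f

/-- Postcomposition with a bimodule morphism. -/
def coindMap (g : Y ⟶ Z) : coindObj ι Y ⟶ coindObj ι Z :=
  linHom
    { toFun := fun f => toCoind ι (ofCoind ι f ≫ g)
      map_add' := fun f f' => Preadditive.add_comp _ _ _ (ofCoind ι f) (ofCoind ι f') g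
      map_smul' := fun e f => Category.assoc (rmul ι (ι e)) (ofCoind ι f) g }

/-- The endofunctor `Hom(A, -)` of the category of `R`-`R`-bimodules. -/
def coindFunctor : BimodCat k R ⥤ BimodCat k R where
  obj Y := coindObj ι Y
  map g := coindMap ι g
  map_id Y := by
    ext f
    exact Category.comp_id (ofCoind ι f)
  map_comp g h := by
    ext f
    exact (Category.assoc (ofCoind ι f) g h).symm

/-- The bijection between morphisms `A ⊗_{R^e} X ⟶ Y` and `X ⟶ Hom(A, Y)`. -/
def indCoindEquiv (X Y : BimodCat k R) : (indObj ι X ⟶ Y) ≃ (X ⟶ coindObj ι Y) where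
  toFun g := linHom
    { toFun := fun x => toCoind ι (into ι x ≫ g)
      map_add' := fun x x' => by
        rw [into_add, Preadditive.add_comp]
        rfl
      map_smul' := fun e x => by
        rw [into_smul, Category.assoc]
        rfl }
  invFun f := indDesc ι (AddMonoidHom.mk' (fun x => ofCoind ι (f.hom x)) (map_add f.hom))
    (map_smul f.hom)
  left_inv _ := ind_hom_ext ι fun _ => rfl
  right_inv _ := rfl

/-- The adjunction between `A ⊗_{R^e} -` and `Hom(A, -)`. -/
def indCoindAdjunction : indFunctor ι ⊣ coindFunctor ι :=
  Adjunction.mkOfHomEquiv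
    { homEquiv := indCoindEquiv ι
      homEquiv_naturality_left_symm := fun _ _ => ind_hom_ext ι fun _ => rfl
      homEquiv_naturality_right := fun _ _ => rfl }

end Coinduction

/-! ### The free bimodule of rank one -/

variable (k R) in
/-- The free bimodule `R^e` on the generator `1 ⊗ 1`. -/
def free : BimodCat k R := ModuleCat.of (Env k R) (Env k R)

/-- An element of the enveloping algebra, regarded as an element of the free bimodule. -/
def toFree (e : Env k R) : free k R := e

section pt

variable {X Y : BimodCat k R}

/-- The morphism `e ↦ e·x` from the free bimodule to `X` classifying the element `x` of `X`. -/
def pt (x : X) : free k R ⟶ X := ModuleCat.ofHom (LinearMap.toSpanSingleton (Env k R) X x)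

theorem pt_apply (x : X) (e : Env k R) : (pt x).hom (toFree e) = e • x := rfl

theorem pt_apply_one (x : X) : (pt x).hom (toFree 1) = x := one_smul _ x

theorem free_hom_ext {f g : free k R ⟶ X} (h : f.hom (toFree 1) = g.hom (toFree 1)) : f = g :=
  ModuleCat.hom_ext (LinearMap.ext_ring h)

theorem pt_comp (x : X) (f : X ⟶ Y) : pt x ≫ f = pt (f.hom x) :=
  free_hom_ext <| by rw [ModuleCat.comp_apply, pt_apply_one, pt_apply_one]

theorem pt_add (x x' : X) : pt (x + x') = pt x + pt x' :=
  free_hom_ext <| by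
    change _ = (pt x).hom (toFree 1) + (pt x').hom (toFree 1)
    rw [pt_apply_one, pt_apply_one, pt_apply_one]

theorem pt_smul (e : Env k R) (x : X) : pt (e • x) = pt (toFree e) ≫ pt x := by
  rw [pt_comp, pt_apply]

theorem pt_one : pt (toFree (1 : Env k R)) = 𝟙 (free k R) :=
  free_hom_ext (pt_apply_one _)

variable (k R) in
/-- The bimodule morphism `1 ⊗ 1 ↦ (1 ⊗ 1) ⊗ (1 ⊗ 1)`, the comultiplication of the free bimodule. -/
def freeComul : free k R ⟶ free k R ⊗ free k R := pt (tmul (toFree 1) (toFree 1))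

variable (k R) in
/-- The bimodule morphism `r ⊗ r' ↦ r r'`, the counit of the free bimodule. -/
def freeCounit : free k R ⟶ 𝟙_ (BimodCat k R) := pt (X := 𝟙_ (BimodCat k R)) (toUnit 1)

theorem freeComul_tensorHom (x : X) (y : Y) :
    freeComul k R ≫ (pt x ⊗ₘ pt y) = pt (tmul x y) := by
  rw [freeComul, pt_comp, tensorHom_tmul, pt_apply_one, pt_apply_one]

theorem freeComul_apply_one :
    (freeComul k R).hom (toFree 1) = tmul (toFree 1) (toFree 1) := pt_apply_one _

theorem freeCounit_apply_one : (freeCounit k R).hom (toFree 1) = toUnit 1 := pt_apply_one _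

/-- The comonoid structure on the free bimodule for which its generator is grouplike. -/
instance : ComonObj (free k R) where
  counit := freeCounit k R
  comul := freeComul k R
  counit_comul := free_hom_ext <| by
    rw [ModuleCat.comp_apply, freeComul_apply_one, whiskerRight_tmul, freeCounit_apply_one]
    rfl
  comul_counit := free_hom_ext <| by
    rw [ModuleCat.comp_apply, freeComul_apply_one, whiskerLeft_tmul, freeCounit_apply_one]
    rfl
  comul_assoc := free_hom_ext <| by
    rw [ModuleCat.comp_apply, ModuleCat.comp_apply, ModuleCat.comp_apply, freeComul_apply_one,
      whiskerLeft_tmul, whiskerRight_tmul, freeComul_apply_one, associator_tmul]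

end pt

/-! ### The total algebra of a monad -/

section Monad

variable (T : Monad (BimodCat k R))

section kl

variable {T} {X Y : BimodCat k R}

/-- The Kleisli extension `T R^e ⟶ T X` of the morphism `R^e ⟶ T X` classifying `y`. -/
def kl (y : T.obj X) : T.obj (free k R) ⟶ T.obj X := T.map (pt y) ≫ T.μ.app X

theorem kl_unit (y : T.obj X) :
    (kl y).hom ((T.η.app (free k R)).hom (toFree 1)) = y := by
  have h : T.η.app (free k R) ≫ kl y = pt y := by
    rw [kl, ← Category.assoc, ← T.η.naturality, Category.assoc]
    exact (congrArg (pt y ≫ ·) (T.left_unit X)).trans (Category.comp_id _)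
  rw [← ModuleCat.comp_apply, h, pt_apply_one]

theorem kl_comp_map (y : T.obj X) (f : X ⟶ Y) : kl y ≫ T.map f = kl ((T.map f).hom y) := by
  rw [kl, kl, ← pt_comp, Functor.map_comp, Category.assoc, Category.assoc]
  exact congrArg (T.map (pt y) ≫ ·) (T.μ.naturality f).symm

theorem kl_comp_mu (y : T.obj (T.obj X)) :
    kl y ≫ T.μ.app X = kl ((T.μ.app X).hom y) := by
  rw [kl, kl, ← pt_comp, Functor.map_comp, Category.assoc, Category.assoc, T.assoc]

theorem kl_comp_kl (b : T.obj (free k R)) (y : T.obj X) :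
    kl b ≫ kl y = kl ((kl y).hom b) := by
  conv_lhs => rw [kl.eq_def y]
  rw [← Category.assoc, kl_comp_map, kl_comp_mu]
  rfl

theorem kl_eta (x : X) : kl ((T.η.app X).hom x) = T.map (pt x) := by
  rw [kl, ← pt_comp, Functor.map_comp, Category.assoc, T.right_unit, Category.comp_id]

theorem kl_one : kl ((T.η.app (free k R)).hom (toFree 1)) = 𝟙 _ := by
  rw [kl_eta, pt_one, CategoryTheory.Functor.map_id]

theorem kl_add [T.toFunctor.Additive] (y y' : T.obj X) : kl (y + y') = kl y + kl y' := by
  rw [kl, pt_add, Functor.map_add, Preadditive.add_comp]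
  rfl

end kl

/-- The bimodule `T R^e`, regarded as a ring whose opposite is the endomorphism ring of `R^e` in
the Kleisli category of `T`. -/
def Total : Type u := T.obj (free k R)

namespace Total

/-- An element of the bimodule `T R^e`, regarded as an element of the total ring. -/
def mk (a : T.obj (free k R)) : Total T := a

variable {T}

/-- An element of the total ring, regarded as an element of the bimodule `T R^e`. -/
def val (a : Total T) : T.obj (free k R) := a

instance : AddCommGroup (Total T) := inferInstanceAs (AddCommGroup (T.obj (free k R)))

/-- The multiplication for which right multiplication by `b` is the Kleisli extension of `b`. -/
instance : Mul (Total T) where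
  mul a b := mk T ((kl b.val).hom a.val)

instance : One (Total T) where
  one := mk T ((T.η.app (free k R)).hom (toFree 1))

theorem mul_def (a b : Total T) : a * b = mk T ((kl b.val).hom a.val) := rfl

variable [T.toFunctor.Additive]

instance : Ring (Total T) where
  __ := (inferInstance : AddCommGroup (Total T))
  left_distrib a b c := by
    change (kl (b.val + c.val)).hom a.val = _
    rw [kl_add]
    rfl
  right_distrib a b c := map_add (kl c.val).hom a.val b.val
  zero_mul a := map_zero (kl a.val).hom
  mul_zero a := by
    have h : kl (0 : T.obj (free k R)) = 0 := by
      have := kl_add (T := T) (X := free k R) 0 0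
      rwa [add_zero, left_eq_add] at this
    change (kl (0 : T.obj (free k R))).hom a.val = 0
    rw [h]
    rfl
  mul_assoc a b c := by
    change (kl b.val ≫ kl c.val).hom a.val = _
    rw [kl_comp_kl]
    rfl
  one_mul a := kl_unit a.val
  mul_one a := by
    change (kl ((T.η.app (free k R)).hom (toFree 1))).hom a.val = a
    rw [kl_one]
    rfl

variable (T) in
/-- The ring homomorphism `e ↦ η(e)` from the enveloping algebra to the total ring. -/
def unitHom : Env k R →+* Total T where
  toFun e := mk T ((T.η.app (free k R)).hom (toFree e))
  map_one' := rfl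
  map_mul' e f := by
    change (T.η.app (free k R)).hom ((pt (toFree f)).hom (toFree e)) =
      (kl ((T.η.app (free k R)).hom (toFree f))).hom ((T.η.app (free k R)).hom (toFree e))
    rw [kl_eta, ← ModuleCat.comp_apply, ← ModuleCat.comp_apply]
    exact congrArg (fun f => f.hom (toFree e)) (T.η.naturality (pt (toFree f)))
  map_zero' := map_zero (T.η.app (free k R)).hom
  map_add' e f := map_add (T.η.app (free k R)).hom (toFree e) (toFree f)

theorem kl_unitHom (e : Env k R) : kl (unitHom T e).val = T.map (pt (toFree e)) := kl_eta _

theorem unitHom_mul (e : Env k R) (a : Total T) : unitHom T e * a = mk T (e • a.val) := by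
  have h : (T.η.app (free k R)).hom (toFree e) =
      e • (T.η.app (free k R)).hom (toFree 1) := by
    rw [← map_smul]
    exact congrArg (T.η.app (free k R)).hom (mul_one e).symm
  change (kl a.val).hom ((T.η.app (free k R)).hom (toFree e)) = _
  rw [h, map_smul, kl_unit]
  rfl

open scoped ModuleCat.Algebra in
instance [T.toFunctor.Linear k] : Algebra k (Total T) :=
  ((unitHom T).comp (algebraMap k (Env k R))).toAlgebra' fun c a => by
    have h : pt (toFree (algebraMap k (Env k R) c)) = c • 𝟙 (free k R) :=
      free_hom_ext (pt_apply_one _ |>.trans (mul_one (algebraMap k (Env k R) c)).symm)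
    rw [RingHom.comp_apply, unitHom_mul, mul_def, kl_unitHom, h, Functor.map_smul,
      CategoryTheory.Functor.map_id]
    rfl

open scoped ModuleCat.Algebra in
variable (T) in
/-- The algebra homomorphism `s ⊗ t : e ↦ η(e)` from the enveloping algebra to the total
algebra. -/
def sourceTarget [T.toFunctor.Linear k] : Env k R →ₐ[k] Total T :=
  { unitHom T with commutes' := fun _ => rfl }

end Total

end Monad

/-! ### The left bialgebroid of a linear bimonad -/

/-- Transport of a comonoid structure along an isomorphism. -/
@[reducible]
def comonObjOfIso {C : Type*} [Category* C] [MonoidalCategory C] {M N : C} (i : M ≅ N)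
    [ComonObj N] : ComonObj M where
  counit := i.hom ≫ ComonObj.counit
  comul := i.hom ≫ ComonObj.comul ≫ (i.inv ⊗ₘ i.inv)
  counit_comul := by
    rw [Category.assoc, Category.assoc, tensorHom_comp_whiskerRight, Iso.inv_hom_id_assoc,
      ComonObj.counit_comul_hom, Iso.hom_inv_id_assoc]
  comul_counit := by
    rw [Category.assoc, Category.assoc, tensorHom_comp_whiskerLeft, Iso.inv_hom_id_assoc,
      ComonObj.comul_counit_hom, Iso.hom_inv_id_assoc]
  comul_assoc := by
    simp only [Category.assoc, tensorHom_comp_whiskerRight_assoc, tensorHom_comp_whiskerLeft,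
      Iso.inv_hom_id_assoc]
    rw [← whiskerRight_comp_tensorHom, ← whiskerLeft_comp_tensorHom, Category.assoc,
      associator_naturality, ComonObj.comul_assoc_assoc]

namespace Bimonad

attribute [local instance] Bimonad.comonoidal

variable (T : Bimonad (BimodCat k R)) {X Y : BimodCat k R}

/-- The comultiplication of `T R^e` induced by that of `R^e`. -/
def totalComul : T.monad.obj (free k R) ⟶ T.monad.obj (free k R) ⊗ T.monad.obj (free k R) :=
  T.monad.map (freeComul k R) ≫ T.comonoidal.δ (free k R) (free k R)

/-- The counit of `T R^e` induced by that of `R^e`. -/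
def totalCounit : T.monad.obj (free k R) ⟶ 𝟙_ (BimodCat k R) :=
  T.monad.map (freeCounit k R) ≫ T.comonoidal.η

/-- Since `T` is oplax monoidal, it carries the comonoid `R^e` to a comonoid. -/
@[reducible]
def totalComonObj : ComonObj (T.monad.obj (free k R)) :=
  Functor.obj.instComonObj (free k R) T.monad.toFunctor

/-- The comonoidal structure of `T` is determined by the comultiplication of `T R^e`. -/
theorem totalComul_tensorHom (x : X) (y : Y) :
    T.totalComul ≫ (T.monad.map (pt x) ⊗ₘ T.monad.map (pt y)) =
      T.monad.map (pt (tmul x y)) ≫ T.comonoidal.δ X Y := by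
  rw [totalComul, Category.assoc, Functor.OplaxMonoidal.δ_natural, ← Functor.map_comp_assoc,
    freeComul_tensorHom]

/-- Compatibility of `μ` with `γ`: on `w = y ⊗ z`, the Kleisli extensions of `y` and `z` applied
to the two tensor factors of the comultiplication. -/
theorem map_pt_tensor_comp_mu (y : T.monad.obj X) (z : T.monad.obj Y) :
    T.monad.map (pt (tmul y z)) ≫ T.comonoidal.δ (T.monad.obj X) (T.monad.obj Y) ≫
        (T.monad.μ.app X ⊗ₘ T.monad.μ.app Y) =
      T.totalComul ≫ (kl y ⊗ₘ kl z) := by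
  rw [← Category.assoc, ← totalComul_tensorHom, Category.assoc, tensorHom_comp_tensorHom]
  rfl

theorem kl_comp_totalComul (b : T.monad.obj (free k R)) :
    kl b ≫ T.totalComul = T.monad.map (pt (T.totalComul.hom b)) ≫
      T.comonoidal.δ (T.monad.obj (free k R)) (T.monad.obj (free k R)) ≫
        (T.monad.μ.app (free k R) ⊗ₘ T.monad.μ.app (free k R)) := by
  have h := T.mu_comul (free k R) (free k R)
  rw [← pt_comp, totalComul, ← Category.assoc, kl_comp_map, kl, ← pt_comp]
  simp only [CategoryTheory.Functor.map_comp, Category.assoc, h]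

theorem kl_comp_totalCounit (b : T.monad.obj (free k R)) :
    kl b ≫ T.totalCounit =
      T.monad.map (pt (X := 𝟙_ (BimodCat k R)) (T.totalCounit.hom b)) ≫ T.comonoidal.η := by
  rw [← pt_comp, totalCounit, ← Category.assoc, kl_comp_map, kl, ← pt_comp]
  simp only [CategoryTheory.Functor.map_comp, Category.assoc, T.mu_counit]

theorem totalComul_one : T.totalComul.hom ((T.monad.η.app (free k R)).hom (toFree 1)) =
    tmul ((T.monad.η.app (free k R)).hom (toFree 1))
      ((T.monad.η.app (free k R)).hom (toFree 1)) := by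
  have h : T.monad.η.app (free k R) ≫ T.totalComul =
      freeComul k R ≫ (T.monad.η.app (free k R) ⊗ₘ T.monad.η.app (free k R)) := by
    rw [totalComul, ← T.eta_comul, ← Category.assoc, ← Category.assoc]
    exact congrArg (· ≫ _) (T.monad.η.naturality (freeComul k R)).symm
  rw [← ModuleCat.comp_apply, h, ModuleCat.comp_apply, freeComul_apply_one, tensorHom_tmul]

theorem totalCounit_one :
    T.totalCounit.hom ((T.monad.η.app (free k R)).hom (toFree 1)) = toUnit 1 := by
  have h : T.monad.η.app (free k R) ≫ T.totalCounit = freeCounit k R := by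
    rw [totalCounit, ← Category.assoc]
    refine (congrArg (· ≫ _) (T.monad.η.naturality (freeCounit k R)).symm).trans ?_
    rw [Category.assoc, T.eta_counit]
    exact Category.comp_id (freeCounit k R)
  rw [← ModuleCat.comp_apply, h, freeCounit_apply_one]

open scoped ModuleCat.Algebra

variable [T.monad.toFunctor.Additive] [T.monad.toFunctor.Linear k]

/-- The algebra homomorphism `s ⊗ t` from the enveloping algebra to the total algebra. -/
abbrev totalι : Env k R →ₐ[k] Total T.monad := Total.sourceTarget T.monad

/-- The identity map, as an isomorphism between the bimodule underlying the algebra `T R^e` over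
`R^e` and the bimodule `T R^e`. -/
def totalIso : bimodOf T.totalι ≅ T.monad.obj (free k R) where
  hom := linHom
    { toFun := fun a => (ofBimod T.totalι a).val
      map_add' := fun _ _ => rfl
      map_smul' := fun e a => Total.unitHom_mul e (ofBimod T.totalι a) }
  inv := linHom
    { toFun := fun a => toBimod T.totalι (Total.mk T.monad a)
      map_add' := fun _ _ => rfl
      map_smul' := fun e a => (Total.unitHom_mul e (Total.mk T.monad a)).symm }

theorem totalIso_inv_rmul (b : Total T.monad) :
    T.totalIso.inv ≫ rmul T.totalι b = kl b.val ≫ T.totalIso.inv := rfl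

/-- The comultiplication of the bialgebroid of `T`. -/
def bialgComul : bimodOf T.totalι ⟶ bimodOf T.totalι ⊗ bimodOf T.totalι :=
  T.totalIso.hom ≫ T.totalComul ≫ (T.totalIso.inv ⊗ₘ T.totalIso.inv)

/-- The counit of the bialgebroid of `T`. -/
def bialgCounit : bimodOf T.totalι ⟶ 𝟙_ (BimodCat k R) := T.totalIso.hom ≫ T.totalCounit

theorem bialgComul_rmul (b c : Total T.monad) :
    T.bialgComul ≫ (rmul T.totalι b ⊗ₘ rmul T.totalι c) =
      T.totalIso.hom ≫ (T.totalComul ≫ (kl b.val ⊗ₘ kl c.val)) ≫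
        (T.totalIso.inv ⊗ₘ T.totalIso.inv) := by
  simp only [bialgComul, Category.assoc, tensorHom_comp_tensorHom, totalIso_inv_rmul]

theorem bialgComul_rmul_ι (e f : Env k R) :
    T.bialgComul ≫ (rmul T.totalι (T.totalι e) ⊗ₘ rmul T.totalι (T.totalι f)) =
      T.totalIso.hom ≫ (T.monad.map (pt (tmul (toFree e) (toFree f))) ≫ T.comonoidal.δ _ _) ≫
        (T.totalIso.inv ⊗ₘ T.totalIso.inv) := by
  rw [bialgComul_rmul, ← totalComul_tensorHom, ← Total.kl_unitHom, ← Total.kl_unitHom]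
  rfl

theorem bialgComul_mem (a : Total T.monad) :
    T.bialgComul.hom (toBimod T.totalι a) ∈ takeuchi T.totalι := by
  intro r
  have h : T.bialgComul ≫ bimodOf T.totalι ◁ rmul T.totalι (T.totalι (sE k r)) =
      T.bialgComul ≫ rmul T.totalι (T.totalι (tE k r)) ▷ bimodOf T.totalι := by
    -- Write the identity as right multiplication by `ι 1`. Both sides then are `T(f) ≫ δ` for a
    -- morphism `f` out of `R^e`, and the two morphisms agree since the tensor product is balanced.
    rw [← id_tensorHom, ← tensorHom_id, ← rmul_one, ← map_one T.totalι, bialgComul_rmul_ι,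
      bialgComul_rmul_ι]
    have h1 := tmul_bal r (toFree (1 : Env k R)) (toFree (1 : Env k R))
    have h2 (e : Env k R) : e • toFree (1 : Env k R) = toFree e := mul_one e
    rw [h2, h2] at h1
    rw [h1]
  exact congrArg (fun f => f.hom (toBimod T.totalι a)) h

theorem bialgComul_mul (a b : Total T.monad) : T.bialgComul.hom (toBimod T.totalι (a * b)) =
    takeuchiMul T.totalι ⟨_, T.bialgComul_mem a⟩ (T.bialgComul.hom (toBimod T.totalι b)) := by
  -- Both sides are values of additive functions of `Δ(b)`, which may thus be replaced by `y ⊗ z`.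
  have key (w : (T.monad.obj (free k R) ⊗ T.monad.obj (free k R) : BimodCat k R)) :
      (T.totalIso.inv ⊗ₘ T.totalIso.inv).hom ((T.monad.map (pt w) ≫
        T.comonoidal.δ (T.monad.obj (free k R)) (T.monad.obj (free k R)) ≫
          (T.monad.μ.app (free k R) ⊗ₘ T.monad.μ.app (free k R))).hom a.val) =
      takeuchiMul T.totalι ⟨_, T.bialgComul_mem a⟩
        ((T.totalIso.inv ⊗ₘ T.totalIso.inv).hom w) := by
    induction w using tmul_induction with
    | hm y z =>
      rw [map_pt_tensor_comp_mu, tensorHom_tmul, takeuchiMul_tmul]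
      exact (congrArg (fun f => f.hom (toBimod T.totalι a))
        (T.bialgComul_rmul (Total.mk T.monad y) (Total.mk T.monad z))).symm
    | ha v w hv hw =>
      rw [pt_add, Functor.map_add, Preadditive.add_comp, map_add, map_add, ← hv, ← hw, ← map_add]
      rfl
  refine Eq.trans ?_ (key (T.totalComul.hom b.val))
  rw [← kl_comp_totalComul]
  rfl

theorem bialgCounit_mul (a b : Total T.monad) (e : Env k R)
    (he : (freeCounit k R).hom (toFree e) = T.bialgCounit.hom (toBimod T.totalι b)) :
    T.bialgCounit.hom (toBimod T.totalι (a * T.totalι e)) =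
      T.bialgCounit.hom (toBimod T.totalι (a * b)) := by
  have h : kl (T.totalι e).val ≫ T.totalCounit = kl b.val ≫ T.totalCounit := by
    have h1 : kl (T.totalι e).val = T.monad.map (pt (toFree e)) := Total.kl_unitHom e
    rw [h1, kl_comp_totalCounit, totalCounit, ← Functor.map_comp_assoc, pt_comp, he]
    rfl
  exact congrArg (fun f => f.hom a.val) h

/-- The left bialgebroid `T R^e` of a `k`-linear bimonad `T`. -/
def bialgebroid : LeftBialgebroid k R where
  A := Total T.monad
  ι := T.totalι
  comon := let _ := T.totalComonObj; comonObjOfIso T.totalIso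
  comul_mem := T.bialgComul_mem
  comul_one := Subtype.ext <| by
    refine (congrArg (T.totalIso.inv ⊗ₘ T.totalIso.inv).hom T.totalComul_one).trans ?_
    rw [tensorHom_tmul]
    rfl
  comul_mul a b := Subtype.ext (T.bialgComul_mul a b)
  counit_one := T.totalCounit_one
  counit_mul_s a b := T.bialgCounit_mul a b _
    ((sE_unit _ (toUnit 1)).trans (mul_one (ofUnit (T.bialgCounit.hom (toBimod T.totalι b)))))
  counit_mul_t a b := T.bialgCounit_mul a b _
    ((tE_unit _ (toUnit 1)).trans (one_mul (ofUnit (T.bialgCounit.hom (toBimod T.totalι b)))))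

/-! ### The comparison with the induction functor -/

/-- The comparison morphism `a ⊗ x ↦ T(x)(a)` from `T R^e ⊗_{R^e} X` to `T X`, where `x` is
regarded as a morphism `R^e ⟶ X`. -/
def comparison (X : BimodCat k R) : indObj T.totalι X ⟶ T.monad.obj X :=
  indDesc T.totalι
    (AddMonoidHom.mk' (fun x => T.totalIso.hom ≫ T.monad.map (pt x))
      (fun x x' => by rw [pt_add, Functor.map_add, Preadditive.comp_add]))
    (fun e x => by
      change T.totalIso.hom ≫ T.monad.map (pt (e • x)) = rmul T.totalι (T.totalι e) ≫
        T.totalIso.hom ≫ T.monad.map (pt x)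
      rw [pt_smul, Functor.map_comp, ← Total.kl_unitHom]
      rfl)

theorem into_comparison (x : X) :
    into T.totalι x ≫ T.comparison X = T.totalIso.hom ≫ T.monad.map (pt x) := rfl

/-- If `T` has a right adjoint `G`, then `Hom(T X, Y) = Hom(X, G Y)`, while the elements of `G Y`
are the morphisms `R^e ⟶ G Y`, that is, `T R^e ⟶ Y`. Hence `G Y` is the coinduced bimodule
`Hom(T R^e, Y)`, which represents `Hom(T R^e ⊗_{R^e} X, Y)`. -/
theorem isIso_comparison [T.monad.toFunctor.IsLeftAdjoint] (X : BimodCat k R) :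
    IsIso (T.comparison X) := by
  let adj := Adjunction.ofIsLeftAdjoint T.monad.toFunctor
  let G := T.monad.toFunctor.rightAdjoint
  refine isIso_of_coyoneda_map_bijective _ fun Y => ?_
  -- The adjunction bijection is additive because `T` is.
  have hadd (f g : free k R ⟶ G.obj Y) : (adj.homEquiv _ _).symm (f + g) =
      (adj.homEquiv _ _).symm f + (adj.homEquiv _ _).symm g := by
    simp only [Adjunction.homEquiv_counit]
    erw [Functor.map_add, Preadditive.add_comp]
  let θ : G.obj Y ⟶ coindObj T.totalι Y := linHom
    { toFun := fun z => toCoind T.totalι (T.totalIso.hom ≫ (adj.homEquiv _ _).symm (pt z))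
      map_add' := fun z z' => by
        rw [pt_add, hadd, Preadditive.comp_add]
        rfl
      map_smul' := fun e z => by
        rw [pt_smul, Adjunction.homEquiv_naturality_left_symm, ← Total.kl_unitHom]
        rfl }
  have hθ : Function.Bijective θ.hom := by
    constructor
    · intro z z' h
      have h1 : pt z = pt z' := (adj.homEquiv _ _).symm.injective ((cancel_epi T.totalIso.hom).1 h)
      rw [← pt_apply_one z, h1, pt_apply_one]
    · intro f
      refine ⟨(adj.homEquiv _ _ (T.totalIso.inv ≫ ofCoind _ f)).hom (toFree 1), ?_⟩
      change T.totalIso.hom ≫ (adj.homEquiv _ _).symm (pt _) = ofCoind _ f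
      rw [← pt_comp, pt_one, Category.id_comp, Equiv.symm_apply_apply, Iso.hom_inv_id_assoc]
  have : IsIso θ := (ConcreteCategory.isIso_iff_bijective θ).2 hθ
  have h : (fun g : T.monad.obj X ⟶ Y => T.comparison X ≫ g) =
      (indCoindEquiv T.totalι X Y).symm ∘ (fun f => f ≫ θ) ∘ adj.homEquiv X Y := by
    funext g
    apply (indCoindEquiv T.totalι X Y).injective
    simp only [Function.comp_apply, Equiv.apply_symm_apply]
    ext x
    change T.totalIso.hom ≫ T.monad.map (pt x) ≫ g =
      T.totalIso.hom ≫ (adj.homEquiv _ _).symm (pt ((adj.homEquiv X Y g).hom x))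
    rw [← pt_comp, Adjunction.homEquiv_naturality_left_symm, Equiv.symm_apply_apply]
  rw [h]
  refine (Equiv.bijective _).comp (Function.Bijective.comp ?_ (Equiv.bijective _))
  exact ⟨fun f g hfg => (cancel_mono θ).1 hfg, fun f => ⟨f ≫ inv θ, by simp⟩⟩

theorem unit_comparison (X : BimodCat k R) :
    indUnit T.totalι X ≫ T.comparison X = T.monad.η.app X := by
  apply ModuleCat.hom_ext
  apply LinearMap.ext
  intro x
  refine (congrArg (fun f => f.hom (toFree 1)) (T.monad.η.naturality (pt x)).symm).trans ?_
  exact congrArg (T.monad.η.app X).hom (pt_apply_one x)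

theorem orbit_comparison (z : indObj T.totalι X) :
    orbit T.totalι z ≫ T.comparison X = T.totalIso.hom ≫ kl ((T.comparison X).hom z) := by
  induction z using itmul_induction with
  | ha y z hy hz =>
    rw [orbit_add, Preadditive.add_comp, hy, hz, map_add, kl_add, Preadditive.comp_add]
  | hm b x =>
    have h : (T.comparison X).hom (itmul T.totalι b x) = (T.monad.map (pt x)).hom b.val := rfl
    rw [h, ← kl_comp_map]
    rfl

theorem mul_comparison (X : BimodCat k R) :
    indMul T.totalι X ≫ T.comparison X =
      (indMap T.totalι (T.comparison X) ≫ T.comparison (T.monad.obj X)) ≫ T.monad.μ.app X :=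
  ind_hom_ext T.totalι fun z => T.orbit_comparison z

/-- The lax comonoidal structure `γ` of the bialgebroid of `T`. -/
def bialgGamma (X Y : BimodCat k R) :
    indObj T.totalι (X ⊗ Y) ⟶ indObj T.totalι X ⊗ indObj T.totalι Y := T.bialgebroid.gamma X Y

/-- The counit map `π` of the bialgebroid of `T`. -/
def bialgPi : indObj T.totalι (𝟙_ (BimodCat k R)) ⟶ 𝟙_ (BimodCat k R) := T.bialgebroid.counitMap

theorem into_bialgGamma (x : X) (y : Y) : into T.totalι (tmul x y) ≫ T.bialgGamma X Y =
    T.bialgComul ≫ (into T.totalι x ⊗ₘ into T.totalι y) := rfl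

theorem comparison_gamma (X Y : BimodCat k R) :
    T.comparison (X ⊗ Y) ≫ T.comonoidal.δ X Y =
      T.bialgGamma X Y ≫ (T.comparison X ⊗ₘ T.comparison Y) :=
  ind_tensor_hom_ext _ fun x y => by
    rw [← Category.assoc, ← Category.assoc, into_bialgGamma, into_comparison, Category.assoc,
      Category.assoc, tensorHom_comp_tensorHom, into_comparison, into_comparison,
      ← totalComul_tensorHom, bialgComul, Category.assoc, Category.assoc,
      tensorHom_comp_tensorHom, Iso.inv_hom_id_assoc, Iso.inv_hom_id_assoc]

theorem comparison_pi :
    T.comparison (𝟙_ (BimodCat k R)) ≫ T.comonoidal.η = T.bialgPi := by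
  refine ind_hom_ext _ fun r => ?_
  change T.totalIso.hom ≫ T.monad.map (pt r) ≫ T.comonoidal.η =
    T.totalIso.hom ≫ kl (T.totalι (sE k (ofUnit r))).val ≫ T.monad.map (freeCounit k R) ≫
      T.comonoidal.η
  have h1 : kl (T.totalι (sE k (ofUnit r))).val = T.monad.map (pt (toFree (sE k (ofUnit r)))) :=
    Total.kl_unitHom _
  have h2 : (freeCounit k R).hom (toFree (sE k (ofUnit r))) = r :=
    (sE_unit _ (toUnit 1)).trans (mul_one (ofUnit r))
  rw [h1, ← Functor.map_comp_assoc, pt_comp, h2]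

variable [T.monad.toFunctor.IsLeftAdjoint]

/-- The comparison morphism as an isomorphism. -/
def comparisonIsoApp (X : BimodCat k R) : indObj T.totalι X ≅ T.monad.obj X :=
  haveI := T.isIso_comparison X
  asIso (T.comparison X)

theorem comparisonIsoApp_hom (X : BimodCat k R) :
    (T.comparisonIsoApp X).hom = T.comparison X := rfl

/-- The comparison morphisms form a natural isomorphism. -/
def comparisonIso : indFunctor T.totalι ≅ T.monad.toFunctor :=
  NatIso.ofComponents T.comparisonIsoApp fun f => ind_hom_ext T.totalι fun x => by
    change into T.totalι (f.hom x) ≫ T.comparison _ = T.totalIso.hom ≫ T.monad.map (pt x) ≫ _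
    rw [into_comparison, ← pt_comp, Functor.map_comp]

/-- The comparison is an isomorphism of monads. -/
def comparisonMonadIso : indMonad T.totalι ≅ T.monad :=
  MonadIso.mk (M := indMonad T.totalι) T.comparisonIso (fun X => T.unit_comparison X)
    (fun X => T.mul_comparison X)

/-- The comparison is an isomorphism of bimonads. -/
def comparisonBimonadIso : BimonadIso T T.bialgebroid.bimonad where
  iso := T.comparisonMonadIso.symm
  comul X Y := by
    change T.comonoidal.δ X Y ≫ ((T.comparisonIsoApp X).inv ⊗ₘ (T.comparisonIsoApp Y).inv) =
      (T.comparisonIsoApp (X ⊗ Y)).inv ≫ T.bialgGamma X Y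
    rw [Iso.eq_inv_comp, ← Category.assoc, comparisonIsoApp_hom, comparison_gamma, Category.assoc,
      tensorHom_comp_tensorHom, ← comparisonIsoApp_hom, ← comparisonIsoApp_hom,
      Iso.hom_inv_id, Iso.hom_inv_id, id_tensorHom_id, Category.comp_id]
  counit := by
    change T.comonoidal.η = (T.comparisonIsoApp _).inv ≫ T.bialgPi
    rw [Iso.eq_inv_comp, comparisonIsoApp_hom, comparison_pi]

end Bimonad

end Bimonads

end

theorem mainTheorem2 {k : Type w} {R : Type u} [CommRing k] [Ring R] [Algebra k R]
    (T : Bimonads.Bimonad (Bimonads.BimodCat k R))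
    (hT : Bimonads.IsKLinear T.monad.toFunctor) :
    (∃ A : Bimonads.LeftBialgebroid k R, Nonempty (Bimonads.BimonadIso T A.bimonad)) ↔
      T.monad.toFunctor.IsLeftAdjoint := by
  constructor
  · rintro ⟨A, ⟨i⟩⟩
    have : A.bimonad.monad.toFunctor.IsLeftAdjoint :=
      (Bimonads.indCoindAdjunction A.ι).isLeftAdjoint
    exact Functor.isLeftAdjoint_of_iso (MonadIso.toNatIso i.iso).symm
  · intro _
    have := hT.additive
    have := hT.linear
    exact ⟨T.bialgebroid, ⟨T.comparisonBimonadIso⟩⟩
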